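/- Let $\mathbb{K}$ be a perfect field and let $F\in\mathbb{K}[[x]][y]$ be monic in $y$ of degree $d\ge 1$, with $\operatorname{char}\mathbb{K}=0$ or $\operatorname{char}\mathbb{K}>d$. Assume that $F$ is separable (over $\mathbb{K}((x))$), and let $\delta_F$ be the $x$-valuation of its discriminant. Conventions. Let $\mathbb{A}$ be a finite product of fields and $H=\sum_i a_i y^i=\sum_{i,j}a_{ij}x^jy^i\in\mathbb{A}[[x]][y]$ be monic. Its Newton polygon $\mathcal{N}(H)$ is the lower convex hull of the points $(i,\operatorname{val}_x(a_i))$ and its boundary polynomial is $\bar H=\sum_{(i,j)\in\mathcal{N}(H)}a_{ij}x^jy^i$. We say that $H$ is quasi-degenerated with edge data $(q,m,P,N)$ if $\bar H=\bigl(P(y^q/x^m)\,x^{m\deg P}\bigr)^N$ with $q>0$ and $m\ge 0$ coprime integers and $P\in\mathbb{A}[Z]$ monic, square-free (that is, square-free over each factor field of $\mathbb{A}$), with $P(0)\in\mathbb{A}^\times$. The lowest edge of $\mathcal{N}(H)$ is the one ending at the vertex $(\deg H,0)$; its slope is written $-m/q$ with $q>0,\ m\ge0$ coprime, and $(q,m)=(1,0)$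 by convention if $\mathcal{N}(H)$ is a point. A Weierstrass polynomial is a monic polynomial in $y$ all of whose other coefficients vanish at $x=0$. The sequence of $F$. Put $\mathbb{K}_0=\mathbb{K}$, $N_0=d$, $e_0=1$, $c_0=-\operatorname{coeff}(F,y^{d-1})/d$, $\pi_0(x,y)=(x,y+c_0(x))$ and $H_0=F(x,y+c_0(x))$. As long as $N_{k-1}=\deg_y H_{k-1}>1$ and $H_{k-1}$ is quasi-degenerated, with edge data $(q_k,m_k,P_k,N_k)$, put $\ell_k=\deg P_k$, $\mathbb{K}_k=\mathbb{K}_{k-1}[Z_k]/(P_k)$, let $z_k$ be the class of $Z_k$, let $s_k,t_k$ be the natural numbers with $q_ks_k-t_km_k=1$ and $0\le t_k<q_k$, and let $G_k\in\mathbb{K}_k[[x]][y]$ be the Weierstrass polynomial of degree $N_k$ such that $$H_{k-1}\bigl(z_k^{t_k}x^{q_k},\,x^{m_k}(y+z_k^{s_k})\bigr)=x^{q_km_k\ell_kN_k}\,G_k\,V_k,\qquad V_k\in\mathbb{K}_k[[x,y]]^\times .$$ Put $c_k=-\operatorname{coeff}(G_k,y^{N_k-1})/N_k$, $H_k=G_k(x,y+c_k(x))$,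 $e_k=e_{k-1}q_k$ and $\pi_k=\pi_{k-1}\circ\sigma_k$ with $\sigma_k(x,y)=\bigl(z_k^{t_k}x^{q_k},\,x^{m_k}(y+z_k^{s_k}+c_k(x))\bigr)$. Let $g$ be the rank at which this stops. $F$ is called quasi-irreducible if $N_g=1$. For $0\le k\le g$ let $v_k(F)$ be the $x$-valuation of $\pi_k^*F\in\mathbb{K}_k[[x]][y]$, let $-m_{k+1}/q_{k+1}$ be the slope of the lowest edge of $\mathcal{N}(H_k)$ (for $k<g$ these are the above $q_{k+1},m_{k+1}$), let $e_{k+1}=e_kq_{k+1}$, and put $$\eta_k=\frac{v_k(F)}{e_k}+N_k\,\frac{m_{k+1}}{e_{k+1}},\qquad \eta(F)=\max_{0\le k\le g}\eta_k .$$ Proposition. The maximum $\eta(F)$ exists and $\eta(F)\le 2\delta_F/d$. If moreover $F$ is quasi-irreducible, then $\eta(F)\ge\delta_F/d$. -/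

import Mathlib

open Polynomial PowerSeries

noncomputable section

namespace QuasiIrred

universe u

section Polygon

variable {A : Type u} [CommRing A]

/-- The `x`-valuation on `A⟦x⟧[y]`: the least `x`-order of a coefficient. -/
def val (H : A⟦X⟧[X]) : ℕ∞ := ⨅ i : ℕ, (H.coeff i).order

/-- The convex hull of the points lying on or above some point `(i, val aᵢ)`, `aᵢ ≠ 0`,
for `H = ∑ aᵢ yⁱ`. -/
def newtonRegion (H : A⟦X⟧[X]) : Set (ℝ × ℝ) :=
  convexHull ℝ {p | ∃ i n : ℕ, p.1 = i ∧ (H.coeff i).order = n ∧ (n : ℝ) ≤ p.2}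

/-- The Newton polygon of `H`: the lower convex hull of the points `(i, val aᵢ)`. -/
def newtonPolygon (H : A⟦X⟧[X]) : Set (ℝ × ℝ) :=
  {p | p ∈ newtonRegion H ∧ ∀ r : ℝ, (p.1, r) ∈ newtonRegion H → p.2 ≤ r}

open Classical in
/-- The boundary polynomial of `H = ∑ aᵢⱼ xʲ yⁱ`: the sum of the terms `aᵢⱼ xʲ yⁱ` with
`(i, j)` on the Newton polygon. -/
def boundaryPoly (H : A⟦X⟧[X]) : A⟦X⟧[X] :=
  ∑ i ∈ Finset.range (H.natDegree + 1),
    Polynomial.monomial i (PowerSeries.mk fun j =>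
      if ((i : ℝ), (j : ℝ)) ∈ newtonPolygon H then PowerSeries.coeff j (H.coeff i) else 0)

/-- The slope of the lowest edge of the Newton polygon of a monic `H` is `-m/q`, with `q, m`
coprime. The lowest edge is the one ending at the vertex `(deg H, 0)`. By convention
`(q, m) = (1, 0)` if the polygon is a single point. -/
def HasLowestSlope (H : A⟦X⟧[X]) (q m : ℕ) : Prop :=
  (newtonPolygon H = {((H.natDegree : ℝ), (0 : ℝ))} ∧ q = 1 ∧ m = 0) ∨
  (0 < q ∧ q.Coprime m ∧
    (∀ p ∈ newtonPolygon H, (m : ℝ) * H.natDegree ≤ m * p.1 + q * p.2) ∧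
    ∃ p ∈ newtonPolygon H, p.1 < H.natDegree ∧ (m : ℝ) * p.1 + q * p.2 = m * H.natDegree)

/-- Square-freeness over a ring `A` that is a finite product of fields: the projection to each
factor (these are the quotients by the maximal ideals of `A`) is square-free. -/
def SquarefreeOver (P : A[X]) : Prop :=
  ∀ M : Ideal A, M.IsMaximal → Squarefree (P.map (Ideal.Quotient.mk M))

/-- `(P(y^q / x^m) x^(m deg P))^N` as an element of `A⟦x⟧[y]`. -/
def quasiHomPower (q m : ℕ) (P : A[X]) (N : ℕ) : A⟦X⟧[X] :=
  (∑ j ∈ Finset.range (P.natDegree + 1),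
    Polynomial.monomial (q * j)
      (PowerSeries.monomial (m * (P.natDegree - j)) (P.coeff j))) ^ N

/-- `H` is quasi-degenerated, with edge data `(q, m, P, N)`. -/
structure IsEdgeData (H : A⟦X⟧[X]) (q m : ℕ) (P : A[X]) (N : ℕ) : Prop where
  q_pos : 0 < q
  coprime : q.Coprime m
  monic : P.Monic
  squarefree : SquarefreeOver P
  isUnit_coeff_zero : IsUnit (P.coeff 0)
  boundary : boundaryPoly H = quasiHomPower q m P N

/-- Weierstrass polynomials of `A⟦x⟧[y]`. -/
def IsWeierstrass (G : A⟦X⟧[X]) : Prop :=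
  G.Monic ∧ ∀ i < G.natDegree, PowerSeries.constantCoeff (G.coeff i) = 0

/-- `c = -coeff(G, y^(N-1)) / N`, with `N = deg G`. -/
def shift (G : A⟦X⟧[X]) : A⟦X⟧ :=
  -(Ring.inverse (G.natDegree : A⟦X⟧) * G.coeff (G.natDegree - 1))

/-- `G(x, y + c(x))` with `c` as above; it has no term of degree `N - 1` in `y`. -/
def depress (G : A⟦X⟧[X]) : A⟦X⟧[X] := G.comp (Polynomial.X + Polynomial.C (shift G))

end Polygon

section Transform

variable {A B : Type u} [CommRing A] [CommRing B]

/-- The substitution `f(x) ↦ f(a x^q)` in power series, followed from `A` to `B` by `φ`. -/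
def substX (φ : A →+* B) (a : B) (q : ℕ) (hq : q ≠ 0) : A⟦X⟧ →+* B⟦X⟧ :=
  ((PowerSeries.expand (R := B) q hq : B⟦X⟧ →ₐ[B] B⟦X⟧) : B⟦X⟧ →+* B⟦X⟧).comp
    ((PowerSeries.rescale a).comp (PowerSeries.map φ))

/-- The pull-back by `(x, y) ↦ (a x^q, x^m (y + b(x)))`. -/
def pullback (φ : A →+* B) (a : B) (q : ℕ) (hq : q ≠ 0) (m : ℕ) (b : B⟦X⟧) :
    A⟦X⟧[X] →+* B⟦X⟧[X] :=
  Polynomial.eval₂RingHom (Polynomial.C.comp (substX φ a q hq))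
    (Polynomial.C (PowerSeries.X ^ m) * (Polynomial.X + Polynomial.C b))

/-- `H(z^t x^q, x^m (y + z^s)) = x^w G V` with `G` Weierstrass of degree `N` and `V` a unit of
`B⟦x, y⟧ = B⟦x⟧⟦y⟧`, where `B = A[Z]/(P)` and `z` is the class of `Z`. -/
def IsTransform (H : A⟦X⟧[X]) (q : ℕ) (hq : q ≠ 0) (m s t : ℕ) (P : A[X]) (N : ℕ)
    (G : (AdjoinRoot P)⟦X⟧[X]) : Prop :=
  IsWeierstrass G ∧ G.natDegree = N ∧
  ∃ V : ((AdjoinRoot P)⟦X⟧)⟦X⟧, IsUnit V ∧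
    ((pullback (AdjoinRoot.of P) (AdjoinRoot.root P ^ t) q hq m
        (PowerSeries.C (AdjoinRoot.root P ^ s)) H : (AdjoinRoot P)⟦X⟧[X]) :
        ((AdjoinRoot P)⟦X⟧)⟦X⟧) =
      PowerSeries.C (PowerSeries.X ^ (q * m * P.natDegree * N)) *
        (G : ((AdjoinRoot P)⟦X⟧)⟦X⟧) * V

end Transform

section Sequence

variable {K : Type u} [Field K]

/-- The data at rank `k`: the residue ring `A = K_k`, the polynomial `H = H_k` (whose degree is
`N_k`), the index `e = e_k = q₁ ⋯ q_k`, and the pull-back `π_k^*`. -/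
structure Stage (K : Type u) [Field K] where
  A : Type u
  [ring : CommRing A]
  H : A⟦X⟧[X]
  e : ℕ
  pull : K⟦X⟧[X] →+* A⟦X⟧[X]

attribute [instance] Stage.ring

/-- The degree `N_k` of `H_k`. -/
def Stage.N (S : Stage K) : ℕ := S.H.natDegree

/-- The map `v_k(G) = val (π_k^* G)`. -/
def Stage.v (S : Stage K) (G : K⟦X⟧[X]) : ℕ∞ := val (S.pull G)

/-- Rank `0`: `H₀ = F(x, y + c₀(x))` and `π₀ = (x, y + c₀(x))`. -/
def Stage.initial (F : K⟦X⟧[X]) : Stage K where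
  A := K
  H := depress F
  e := 1
  pull := Polynomial.compRingHom (Polynomial.X + Polynomial.C (shift F))

/-- The passage to the next rank: `K_k = K_(k-1)[Z]/(P)`, `H_k = G(x, y + c_k(x))` and
`π_k = π_(k-1) ∘ σ_k` with `σ_k = (z^t x^q, x^m (y + z^s + c_k(x)))`. -/
def Stage.next (S : Stage K) (q : ℕ) (hq : q ≠ 0) (m s t : ℕ) (P : S.A[X])
    (G : (AdjoinRoot P)⟦X⟧[X]) : Stage K where
  A := AdjoinRoot P
  H := depress G
  e := S.e * q
  pull := (pullback (AdjoinRoot.of P) (AdjoinRoot.root P ^ t) q hq m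
    (PowerSeries.C (AdjoinRoot.root P ^ s) + shift G)).comp S.pull

/-- `Reaches F k S`: the sequence attached to `F` reaches rank `k`, with data `S`. The sequence
continues as long as `N_k > 1` and `H_k` is quasi-degenerated. -/
inductive Reaches (F : K⟦X⟧[X]) : ℕ → Stage K → Prop
  | zero : Reaches F 0 (Stage.initial F)
  | succ {k : ℕ} {S : Stage K} (hS : Reaches F k S) (hN : 1 < S.N)
      {q m : ℕ} {P : S.A[X]} {N : ℕ} (hedge : IsEdgeData S.H q m P N)
      {s t : ℕ} (hst : q * s = t * m + 1) (ht : t < q)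
      {G : (AdjoinRoot P)⟦X⟧[X]}
      (hG : IsTransform S.H q hedge.q_pos.ne' m s t P N G) :
      Reaches F (k + 1) (S.next q hedge.q_pos.ne' m s t P G)

/-- `F` is quasi-irreducible: the sequence attached to `F` reaches some `N_g = 1`. -/
def QuasiIrreducible (F : K⟦X⟧[X]) : Prop :=
  ∃ (g : ℕ) (S : Stage K), Reaches F g S ∧ S.N = 1

/-- The numbers `η_k = v_k(F) / e_k + N_k m_(k+1) / e_(k+1)`, `0 ≤ k ≤ g`, where
`-m_(k+1) / q_(k+1)` is the slope of the lowest edge of `H_k` and `e_(k+1) = e_k q_(k+1)`. -/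
def etaValues (F : K⟦X⟧[X]) : Set ℝ :=
  {r | ∃ (k : ℕ) (S : Stage K) (v q m : ℕ), Reaches F k S ∧ S.v F = v ∧
    HasLowestSlope S.H q m ∧ r = (v : ℝ) / S.e + (S.N : ℝ) * m / ((S.e : ℝ) * q)}

/-- The truncation precision `η(F) = max η_k`. -/
def eta (F : K⟦X⟧[X]) : ℝ := sSup (etaValues F)

end Sequence

end QuasiIrred

end

namespace QuasiIrred

universe u

/-! ### Resultants of a monic polynomial with its derivative -/

section Resultant

variable {R : Type*} [CommRing R]

/-! The proof does a double bookkeeping along the sequence: each step removes a known amount from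
the discriminant and adds a comparable amount to the valuation of the pull-back.

At rank `k` write `π_k^* F = x^v H U` with `U` a unit at the origin, let `Φ` be the geometric points
of `K_k`, let `N = deg H`, and let `D` be the sum over `Φ` of the orders of the discriminants of
`H`. Then `e |Φ| N = d`. A step along an edge of slope `-m/q` lowers `D` by `|Φ| N (N - 1) m / q`,
while `d v / e` grows by `|Φ| N² m / q`. As `N ≥ 2`, these satisfy `N (N - 1) ≤ N² ≤ 2 N (N - 1)`.
So if `T = δ - D` is the part of the discriminant used up so far, then `T ≤ d v / e ≤ 2 T` at every
rank. This is the invariant `IsBalanced`, preserved by `IsBalanced.transform`.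

The same comparison for the lowest edge of `H`, whether or not `H` is quasi-degenerated, gives `d
η_k ≤ 2 T + 2 D = 2 δ` (`IsBalanced.eta_le`). If `N = 1`, then `H = y` and `D = 0`, so `d η ≥ d v /
e ≥ T = δ`. The maximum exists because the `η_k` are bounded and have a common denominator
(`IsBalanced.exists_mul_eq_natCast`).

The loss in the discriminant comes from `smul_discrOrder_eq_sum`: over an algebraically closed
field, `h(x^q, x^m y) / x^(mN)` is a product of pairwise coprime twists of the transforms `G_i`, one
for each `w` with `w^q = z_i`. Coprime factors contribute additively to the order of the
discriminant, and undoing the scaling by `x^m` costs `N (N - 1) m`. -/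

lemma resultant_eq_of_natDegree_le {f g : R[X]} (hf : f.Monic) {n : ℕ} (hn : g.natDegree ≤ n) :
    f.resultant g f.natDegree n = f.resultant g := by
  obtain ⟨k, rfl⟩ := Nat.exists_eq_add_of_le hn
  rw [Polynomial.resultant_add_right_deg _ _ _ _ _ le_rfl, Polynomial.coeff_natDegree,
    hf.leadingCoeff, one_pow, one_mul]

/-- Modulo `f` the derivative of `f * g` is `f' * g`, and symmetrically modulo `g`. The cross terms
are left unsimplified: later only their being units matters. -/
lemma resultant_derivative_mul {f g : R[X]} (hf : f.Monic) (hg : g.Monic) :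
    (f * g).resultant (derivative (f * g)) =
      f.resultant (derivative f) * (f.resultant g * g.resultant f) *
        g.resultant (derivative g) := by
  -- The second formal degree is fixed at `deg f + deg g`, since the true degree of the derivative
  -- may drop; against a monic `f` this does not change the resultant.
  have key : ∀ {f g : R[X]}, f.Monic → g.Monic →
      f.resultant (derivative (f * g)) f.natDegree (f.natDegree + g.natDegree) =
        f.resultant (derivative f) * f.resultant g := by
    intro f g hf hg
    have h1 := natDegree_derivative_le f
    have h2 := natDegree_derivative_le g
    rw [derivative_mul, resultant_add_mul_right _ _ _ _ _ (by omega) le_rfl,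
      resultant_eq_of_natDegree_le hf
        (natDegree_mul_le.trans (Nat.add_le_add_right (h1.trans (Nat.sub_le _ _)) _)),
      ← resultant_eq_of_natDegree_le hf natDegree_mul_le, resultant_mul_right _ _ _ _ le_rfl]
  have hd : (derivative (f * g)).natDegree ≤ f.natDegree + g.natDegree :=
    (natDegree_derivative_le _).trans ((Nat.sub_le _ _).trans natDegree_mul_le)
  rw [← resultant_eq_of_natDegree_le (hf.mul hg) hd, hf.natDegree_mul hg,
    resultant_mul_left _ _ _ _ hd, key hf hg, mul_comm f g, add_comm, key hg hf]
  ring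

lemma resultant_derivative_map {S : Type*} [CommRing S] (φ : R →+* S) {f : R[X]}
    (hf : f.Monic) :
    (f.map φ).resultant (derivative (f.map φ)) = φ (f.resultant (derivative f)) := by
  nontriviality S
  rw [← resultant_map_map, ← derivative_map, ← hf.natDegree_map φ]
  exact (resultant_eq_of_natDegree_le (hf.map φ)
    (by rw [derivative_map]; exact natDegree_map_le)).symm

lemma resultant_derivative_taylor (f : R[X]) (r : R) :
    (f.taylor r).resultant (derivative (f.taylor r)) = f.resultant (derivative f) := by
  rw [show derivative (f.taylor r) = (derivative f).taylor r by
    simp [taylor_apply, derivative_comp], resultant_taylor]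

/-- `scaleRoots` weights each coefficient by its distance to the top degree, so differentiation has
to lower that degree by exactly one. This is one of the places that need the degree to be nonzero in
the base field. -/
lemma derivative_scaleRoots {f : R[X]} (r : R)
    (hf : (derivative f).natDegree = f.natDegree - 1) :
    derivative (f.scaleRoots r) = (derivative f).scaleRoots r := by
  ext i
  simp only [Polynomial.coeff_derivative, coeff_scaleRoots, hf]
  rw [show f.natDegree - (i + 1) = f.natDegree - 1 - i by omega]
  ring

lemma resultant_derivative_scaleRoots {f : R[X]} (r : R)
    (hf : (derivative f).natDegree = f.natDegree - 1) :
    (f.scaleRoots r).resultant (derivative (f.scaleRoots r)) =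
      r ^ (f.natDegree * (f.natDegree - 1)) * f.resultant (derivative f) := by
  rw [derivative_scaleRoots r hf, resultant_scaleRoots, hf]

lemma natDegree_derivative_of_monic [Nontrivial R] {f : R[X]} (hf : f.Monic)
    (hn : f.natDegree = 0 ∨ (f.natDegree : R) ≠ 0) :
    (derivative f).natDegree = f.natDegree - 1 := by
  rcases Nat.eq_zero_or_pos f.natDegree with h | h
  · rw [eq_one_of_monic_natDegree_zero hf h]; simp
  refine le_antisymm (natDegree_derivative_le f) (le_natDegree_of_ne_zero ?_)
  rw [Polynomial.coeff_derivative, Nat.sub_add_cancel h, coeff_natDegree, hf.leadingCoeff, one_mul,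
    ← Nat.cast_add_one, Nat.sub_add_cancel h]
  exact hn.resolve_left h.ne'

lemma resultant_derivative_eq_discr {f : R[X]} (hf : f.Monic) (hn : 0 < f.natDegree) :
    f.resultant (derivative f) =
      (-1) ^ (f.natDegree * (f.natDegree - 1) / 2) * f.discr := by
  rw [← resultant_eq_of_natDegree_le hf (natDegree_derivative_le f),
    resultant_deriv (natDegree_pos_iff_degree_pos.1 hn), hf.leadingCoeff, mul_one]

end Resultant

/-! ### Order of the discriminant over `L⟦X⟧` -/

section Order

variable {L : Type*} [Field L]

/-- The `x`-order of the resultant of `f` and `∂f/∂y`: up to sign, that of the discriminant. -/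
noncomputable def discrOrder (f : L⟦X⟧[X]) : ℕ∞ := (f.resultant (derivative f)).order

lemma discrOrder_eq {f : L⟦X⟧[X]} (hf : f.Monic) (hn : 0 < f.natDegree) :
    discrOrder f = f.discr.order := by
  rw [discrOrder, resultant_derivative_eq_discr hf hn, PowerSeries.order_mul,
    order_zero_of_unit ((isUnit_one (M := L⟦X⟧)).neg.pow _), zero_add]

/-- For monic `f`, coprimality means that the resultant is a unit; this is visible on its constant
term, and the resultant commutes with reduction at `x = 0`. -/
lemma isCoprime_of_map_constantCoeff {f g : L⟦X⟧[X]} (hf : f.Monic)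
    (h : IsCoprime (f.map (PowerSeries.constantCoeff (R := L))) (g.map (PowerSeries.constantCoeff (R := L)))) :
    IsCoprime f g := by
  rw [← isUnit_resultant_iff_isCoprime hf, PowerSeries.isUnit_iff_constantCoeff,
    ← resultant_map_map, ← hf.natDegree_map (PowerSeries.constantCoeff (R := L)),
    resultant_eq_of_natDegree_le (hf.map _) natDegree_map_le,
    isUnit_resultant_iff_isCoprime (hf.map _)]
  exact h

lemma discrOrder_mul {f g : L⟦X⟧[X]} (hf : f.Monic) (hg : g.Monic) (h : IsCoprime f g) :
    discrOrder (f * g) = discrOrder f + discrOrder g := by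
  rw [discrOrder, resultant_derivative_mul hf hg, PowerSeries.order_mul, PowerSeries.order_mul,
    order_zero_of_unit (((isUnit_resultant_iff_isCoprime hf).2 h).mul
      ((isUnit_resultant_iff_isCoprime hg).2 h.symm)), add_zero]
  rfl

lemma discrOrder_prod {ι : Type*} (s : Finset ι) (f : ι → L⟦X⟧[X])
    (hf : ∀ i ∈ s, (f i).Monic) (h : (s : Set ι).Pairwise (Function.onFun IsCoprime f)) :
    discrOrder (∏ i ∈ s, f i) = ∑ i ∈ s, discrOrder (f i) := by
  classical
  induction s using Finset.induction_on with
  | empty => simp [discrOrder]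
  | insert a s ha ih =>
    rw [Finset.prod_insert ha, Finset.sum_insert ha, discrOrder_mul (hf a (by simp)), ih]
    · exact fun i hi => hf i (by simp [hi])
    · exact h.mono (by simp)
    · exact monic_prod_of_monic _ _ fun i hi => hf i (by simp [hi])
    · exact IsCoprime.prod_right fun i hi =>
        h (by simp) (by simp [hi]) (by rintro rfl; exact ha hi)

lemma discrOrder_taylor (f : L⟦X⟧[X]) (r : L⟦X⟧) : discrOrder (f.taylor r) = discrOrder f := by
  rw [discrOrder, resultant_derivative_taylor, discrOrder]

lemma discrOrder_scaleRoots {f : L⟦X⟧[X]} (hf : f.Monic) (hn : (f.natDegree : L) ≠ 0)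
    (r : L⟦X⟧) :
    discrOrder (f.scaleRoots r) = (f.natDegree * (f.natDegree - 1)) • r.order + discrOrder f := by
  have hn' : (f.natDegree : L⟦X⟧) ≠ 0 := by
    intro h
    apply hn
    simpa using congrArg (PowerSeries.constantCoeff (R := L)) h
  rw [discrOrder, resultant_derivative_scaleRoots r (natDegree_derivative_of_monic hf (.inr hn')),
    PowerSeries.order_mul, order_pow, discrOrder]

lemma order_rescale {a : L} (ha : a ≠ 0) (f : L⟦X⟧) : (rescale a f).order = f.order := by
  apply le_antisymm
  · refine le_order _ _ fun i hi => ?_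
    have := coeff_of_lt_order i hi
    rw [coeff_rescale] at this
    exact (mul_eq_zero.1 this).resolve_left (pow_ne_zero _ ha)
  · exact le_order _ _ fun i hi => by rw [coeff_rescale, coeff_of_lt_order i hi, mul_zero]

lemma discrOrder_map_rescale {a : L} (ha : a ≠ 0) {f : L⟦X⟧[X]} (hf : f.Monic) :
    discrOrder (f.map (rescale a)) = discrOrder f := by
  rw [discrOrder, resultant_derivative_map _ hf, order_rescale ha, discrOrder]

lemma discrOrder_map_expand {q : ℕ} (hq : q ≠ 0) {f : L⟦X⟧[X]} (hf : f.Monic) :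
    discrOrder (f.map ((PowerSeries.expand q hq : L⟦X⟧ →ₐ[L] L⟦X⟧) : L⟦X⟧ →+* L⟦X⟧)) =
      q • discrOrder f := by
  rw [discrOrder, resultant_derivative_map _ hf, RingHom.coe_coe, order_expand, discrOrder]

end Order

/-! ### Newton polygons, lowest slopes and edge data -/

section NewtonPolygon

variable {A : Type u} [CommRing A] {H : A⟦X⟧[X]}

lemma mem_newtonRegion {i n : ℕ} (h : (H.coeff i).order = n) {r : ℝ} (hr : (n : ℝ) ≤ r) :
    ((i : ℝ), r) ∈ newtonRegion H :=
  subset_convexHull ℝ _ ⟨i, n, rfl, h, hr⟩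

lemma le_of_mem_newtonRegion {a b c : ℝ} (hb : 0 ≤ b)
    (h : ∀ i n : ℕ, (H.coeff i).order = n → c ≤ a * i + b * n) {p : ℝ × ℝ}
    (hp : p ∈ newtonRegion H) : c ≤ a * p.1 + b * p.2 := by
  have hconv : Convex ℝ {p : ℝ × ℝ | c ≤ a * p.1 + b * p.2} :=
    convex_halfSpace_ge ⟨fun x y => by simp; ring, fun k x => by simp; ring⟩ c
  refine convexHull_min ?_ hconv hp
  rintro p ⟨i, n, h1, h2, h3⟩
  have := h i n h2
  have := mul_le_mul_of_nonneg_left h3 hb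
  simp only [Set.mem_ofPred_eq, h1]
  linarith

lemma finite_setOf_order (H : A⟦X⟧[X]) :
    {p : ℝ × ℝ | ∃ i n : ℕ, p = ((i : ℝ), (n : ℝ)) ∧ (H.coeff i).order = n}.Finite := by
  refine ((Finset.range (H.natDegree + 1)).finite_toSet.image
    fun i : ℕ => ((i : ℝ), ((H.coeff i).order.toNat : ℝ))).subset ?_
  rintro _ ⟨i, n, rfl, h⟩
  refine ⟨i, ?_, by simp [h]⟩
  simp only [Finset.coe_range, Set.mem_Iio]
  by_contra hi
  rw [Polynomial.coeff_eq_zero_of_natDegree_lt (by omega), order_zero] at h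
  exact ENat.top_ne_natCast n h

/-- The region lies above the convex hull of finitely many lattice points; that hull has compact
vertical fibres, so a lowest point is attained. -/
lemma exists_mem_newtonPolygon_le {p : ℝ × ℝ} (hp : p ∈ newtonRegion H) :
    ∃ r ≤ p.2, (p.1, r) ∈ newtonPolygon H := by
  set S : Set (ℝ × ℝ) :=
    {p : ℝ × ℝ | ∃ i n : ℕ, p = ((i : ℝ), (n : ℝ)) ∧ (H.coeff i).order = n} with hS
  have hSub : convexHull ℝ S ⊆ newtonRegion H := by
    refine convexHull_mono ?_
    rintro _ ⟨i, n, rfl, h⟩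
    exact ⟨i, n, rfl, h, le_rfl⟩
  have habove : newtonRegion H ⊆ {p | ∃ r ≤ p.2, (p.1, r) ∈ convexHull ℝ S} := by
    refine convexHull_min ?_ ?_
    · rintro ⟨a, b⟩ ⟨i, n, h1, h2, h3⟩
      exact ⟨n, h3, subset_convexHull ℝ _ ⟨i, n, by simp_all, h2⟩⟩
    · rintro ⟨a, b⟩ ⟨r, hr, hr'⟩ ⟨a', b'⟩ ⟨s, hs, hs'⟩ x y hx hy hxy
      refine ⟨x * r + y * s, ?_, ?_⟩
      · simp only [Prod.snd_add, Prod.smul_snd, smul_eq_mul]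
        gcongr
      · simpa using convex_convexHull ℝ S hr' hs' hx hy hxy
  have hcomp : IsCompact (convexHull ℝ S ∩ {z | z.1 = p.1}) :=
    ((finite_setOf_order H).isCompact_convexHull ℝ).inter_right
      (isClosed_eq continuous_fst continuous_const)
  obtain ⟨r, hr, hr'⟩ := habove hp
  obtain ⟨z, ⟨hz1, hz2⟩, hz3⟩ :=
    hcomp.exists_isMinOn ⟨(p.1, r), hr', rfl⟩ continuous_snd.continuousOn
  have hz2 : z.1 = p.1 := hz2
  refine ⟨z.2, (hz3 ⟨hr', rfl⟩).trans hr, ?_, ?_⟩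
  · rw [← hz2]; exact hSub hz1
  · intro s hs
    obtain ⟨r', h1, h2⟩ := habove hs
    exact le_trans (hz3 ⟨h2, rfl⟩) h1

lemma mem_newtonPolygon_of_isMin {a b : ℝ} (hb : 0 < b) {i₀ n₀ : ℕ}
    (h₀ : (H.coeff i₀).order = n₀)
    (h : ∀ i n : ℕ, (H.coeff i).order = n → a * i₀ + b * n₀ ≤ a * i + b * n) :
    ((i₀ : ℝ), (n₀ : ℝ)) ∈ newtonPolygon H := by
  refine ⟨mem_newtonRegion h₀ le_rfl, fun r hr => ?_⟩
  have := le_of_mem_newtonRegion hb.le h hr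
  simp only [add_le_add_iff_left] at this
  exact le_of_mul_le_mul_left this hb

lemma order_coeff_natDegree [Nontrivial A] (hH : H.Monic) :
    (H.coeff H.natDegree).order = (0 : ℕ) := by
  rw [coeff_natDegree, hH.leadingCoeff]; simp

lemma natDegree_mem_newtonPolygon [Nontrivial A] (hH : H.Monic) :
    ((H.natDegree : ℝ), (0 : ℝ)) ∈ newtonPolygon H := by
  have := mem_newtonPolygon_of_isMin (a := 0) (b := 1) one_pos (order_coeff_natDegree hH)
    fun i n _ => by simp
  simpa using this

/-- All the monomials of `H` lie on or above the line through the lowest edge. -/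
lemma HasLowestSlope.le {q m : ℕ} (h : HasLowestSlope H q m) {i n : ℕ}
    (hi : (H.coeff i).order = n) : m * H.natDegree ≤ m * i + q * n := by
  rcases h with ⟨-, rfl, rfl⟩ | ⟨-, -, h, -⟩
  · simp
  obtain ⟨r, hr, hr'⟩ := exists_mem_newtonPolygon_le (mem_newtonRegion hi le_rfl)
  have h1 := h _ hr'
  have h2 : (q : ℝ) * r ≤ q * n := by gcongr
  have : ((m * H.natDegree : ℕ) : ℝ) ≤ ((m * i + q * n : ℕ) : ℝ) := by
    push_cast
    simp only at h1
    linarith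
  exact_mod_cast this

lemma HasLowestSlope.pos {q m : ℕ} (h : HasLowestSlope H q m) : 0 < q := by
  rcases h with ⟨-, rfl, -⟩ | ⟨h, -⟩
  · exact one_pos
  · exact h

/-- The lowest edge must contain a lattice point `(i, n)` of `H` with `i < deg H`; coprimality then
makes `q` divide `deg H - i`. This bounds the denominators of the `η_k`. -/
lemma HasLowestSlope.le_natDegree {q m : ℕ} (h : HasLowestSlope H q m)
    (hN : 0 < H.natDegree) : q ≤ H.natDegree := by
  have hle := fun i n hi => h.le (i := i) (n := n) hi
  rcases h with ⟨-, rfl, -⟩ | ⟨hq, hqm, -, p, hp, hp1, hp2⟩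
  · exact hN
  by_contra hlt
  -- The half-plane above the edge line, with the part of the line left of `deg H` removed. If no
  -- lattice point of `H` lay on that part, this convex set would contain the whole region, contrary
  -- to the point `p`.
  have hconv : Convex ℝ {p : ℝ × ℝ | (m : ℝ) * H.natDegree ≤ m * p.1 + q * p.2 ∧
      (m * p.1 + q * p.2 ≤ (m : ℝ) * H.natDegree → (H.natDegree : ℝ) ≤ p.1)} := by
    rintro ⟨a, b⟩ ⟨h1, h2⟩ ⟨a', b'⟩ ⟨h3, h4⟩ x y hx hy hxy
    simp only [Set.mem_ofPred_eq, Prod.fst_add, Prod.smul_fst, smul_eq_mul, Prod.snd_add,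
      Prod.smul_snd] at h1 h2 h3 h4 ⊢
    have e1 := mul_nonneg hx (sub_nonneg.2 h1)
    have e2 := mul_nonneg hy (sub_nonneg.2 h3)
    have e3 : y = 1 - x := by linarith
    subst e3
    refine ⟨by linarith, fun h5 => ?_⟩
    have k1 : x * (H.natDegree : ℝ) ≤ x * a := by
      rcases hx.eq_or_lt with h0 | h0
      · simp [← h0]
      · exact mul_le_mul_of_nonneg_left
          (h2 (le_of_mul_le_mul_left (by linarith : x * _ ≤ x * _) h0)) hx
    have k2 : (1 - x) * (H.natDegree : ℝ) ≤ (1 - x) * a' := by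
      rcases hy.eq_or_lt with h0 | h0
      · simp [← h0]
      · exact mul_le_mul_of_nonneg_left
          (h4 (le_of_mul_le_mul_left (by linarith : (1 - x) * _ ≤ (1 - x) * _) h0)) hy
    linarith
  refine hp1.not_ge ((convexHull_min ?_ hconv hp.1).2 hp2.le)
  rintro ⟨a, b⟩ ⟨i, n, h1, h2, h3⟩
  simp only at h1 h3
  subst h1
  have k1 := hle i n h2
  have k2 : (m : ℝ) * H.natDegree ≤ m * i + q * n := by exact_mod_cast k1
  have k3 : (q : ℝ) * n ≤ q * b := by gcongr
  refine ⟨by simp only; linarith, fun h4 => ?_⟩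
  simp only at h4 ⊢
  by_contra h5
  have h5 : i < H.natDegree := by exact_mod_cast not_le.1 h5
  have h6 : m * H.natDegree = m * i + q * n := by
    have : (m : ℝ) * H.natDegree = m * i + q * n := by linarith
    exact_mod_cast this
  have h7 : q ∣ m * (H.natDegree - i) := by
    rw [Nat.mul_sub, h6, Nat.add_sub_cancel_left]
    exact dvd_mul_right _ _
  have := Nat.le_of_dvd (by omega) (hqm.dvd_of_dvd_mul_left h7)
  omega

lemma exists_hasLowestSlope [Nontrivial A] (hH : H.Monic) : ∃ q m, HasLowestSlope H q m := by
  classical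
  set N := H.natDegree with hN
  by_cases h0 : ∀ i < N, H.coeff i = 0
  · have hi : ∀ i n : ℕ, (H.coeff i).order = n → i = N := by
      intro i n h
      by_contra hne
      have : H.coeff i = 0 := by
        rcases lt_or_gt_of_ne hne with h1 | h1
        · exact h0 i h1
        · exact Polynomial.coeff_eq_zero_of_natDegree_lt h1
      rw [this, order_zero] at h
      exact ENat.top_ne_natCast n h
    refine ⟨1, 0, .inl ⟨?_, rfl, rfl⟩⟩
    have hmem := natDegree_mem_newtonPolygon hH
    refine Set.eq_singleton_iff_unique_mem.2 ⟨hmem, fun p hp => ?_⟩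
    have h1 := le_of_mem_newtonRegion (a := 1) (b := 0) (c := N) le_rfl
      (fun i n h => by simp [hi i n h]) hp.1
    have h2 := le_of_mem_newtonRegion (a := -1) (b := 0) (c := -N) le_rfl
      (fun i n h => by simp [hi i n h]) hp.1
    have h3 : p.1 = N := by linarith
    have h4 := hp.2 0 (by rw [h3]; exact hmem.1)
    have h5 := le_of_mem_newtonRegion (a := 0) (b := 1) (c := 0) zero_le_one
      (fun i n h => by simp) hp.1
    exact Prod.ext h3 (by simp only; linarith)
  · push Not at h0
    set I := (Finset.range N).filter fun i => H.coeff i ≠ 0 with hI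
    -- Among the lines through `(N, 0)` and a point of `H` to its left, the one of smallest
    -- steepness carries the lowest edge.
    obtain ⟨i₀, hi₀, hmin⟩ := I.exists_min_image
      (fun i => ((H.coeff i).order.toNat : ℚ) / ((N - i : ℕ) : ℚ))
      (by obtain ⟨i, h1, h2⟩ := h0; exact ⟨i, by simp [hI, h1, h2]⟩)
    simp only [hI, Finset.mem_filter, Finset.mem_range] at hi₀ hmin
    set a := (H.coeff i₀).order.toNat with ha
    have ha' : (H.coeff i₀).order = a := (coe_toNat_order hi₀.2).symm
    set k := N - i₀ with hk
    have hk0 : 0 < k := by omega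
    set g := Nat.gcd k a with hg
    have hg0 : 0 < g := Nat.gcd_pos_of_pos_left _ hk0
    obtain ⟨q, hq⟩ := Nat.gcd_dvd_left k a
    obtain ⟨m, hm⟩ := Nat.gcd_dvd_right k a
    rw [← hg] at hq hm
    have hq0 : 0 < q := Nat.pos_of_ne_zero (by rintro rfl; omega)
    have hcop : q.Coprime m := by
      have := Nat.coprime_div_gcd_div_gcd (m := k) (n := a) hg0
      rwa [← hg, hq, hm, Nat.mul_div_cancel_left _ hg0, Nat.mul_div_cancel_left _ hg0] at this
    have hedge : m * N = m * i₀ + q * a := by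
      have : N = i₀ + k := by omega
      rw [this, Nat.mul_add, hm, hq]
      ring
    have hline : ∀ i n : ℕ, (H.coeff i).order = n → m * N ≤ m * i + q * n := by
      intro i n hin
      rcases lt_or_ge i N with h | h
      · have hne : H.coeff i ≠ 0 := by
          intro h'; rw [h', order_zero] at hin; exact ENat.top_ne_natCast n hin
        have h1 := hmin i ⟨h, hne⟩
        rw [hin, ENat.toNat_natCast, div_le_div_iff₀ (by exact_mod_cast hk0)
          (by exact_mod_cast (by omega : 0 < N - i))] at h1
        have h2 : a * (N - i) ≤ n * k := by exact_mod_cast h1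
        rw [hm, hq] at h2
        have h3 : g * (m * (N - i)) ≤ g * (q * n) := by linarith
        have h4 := Nat.le_of_mul_le_mul_left h3 hg0
        have : N = i + (N - i) := by omega
        rw [this, Nat.mul_add]
        omega
      · exact (Nat.mul_le_mul_left m h).trans (Nat.le_add_right _ _)
    refine ⟨q, m, .inr ⟨hq0, hcop, fun p hp => ?_, ((i₀ : ℝ), (a : ℝ)), ?_, ?_, ?_⟩⟩
    · exact le_of_mem_newtonRegion (by positivity) (fun i n h => by exact_mod_cast hline i n h) hp.1
    · refine mem_newtonPolygon_of_isMin (a := m) (b := q) (by exact_mod_cast hq0) ha' ?_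
      intro i n h
      have := hline i n h
      rw [hedge] at this
      exact_mod_cast this
    · exact Nat.cast_lt.2 hi₀.1
    · simp only [← hN]
      exact_mod_cast hedge.symm

lemma HasLowestSlope.eq_zero_of_eq_X [Nontrivial A] {q m : ℕ}
    (h : HasLowestSlope (Polynomial.X : A⟦X⟧[X]) q m) : m = 0 := by
  rcases h with ⟨-, -, h⟩ | ⟨-, -, -, p, hp, hp1, -⟩
  · exact h
  · have h1 := le_of_mem_newtonRegion (H := (Polynomial.X : A⟦X⟧[X])) (a := 1) (b := 0) (c := 1)
      le_rfl (fun i n h => ?_) hp.1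
    · rw [natDegree_X] at hp1
      norm_num at hp1 h1
      linarith
    · rw [Polynomial.coeff_X] at h
      split_ifs at h with h2
      · simp [← h2]
      · rw [order_zero] at h; exact absurd h (ENat.top_ne_natCast n)

lemma coeff_coeff_boundaryPoly (H : A⟦X⟧[X]) (i j : ℕ) (hi : i ≤ H.natDegree)
    [Decidable (((i : ℝ), (j : ℝ)) ∈ newtonPolygon H)] :
    PowerSeries.coeff j ((boundaryPoly H).coeff i) =
      if ((i : ℝ), (j : ℝ)) ∈ newtonPolygon H then PowerSeries.coeff j (H.coeff i) else 0 := by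
  simp only [boundaryPoly, finsetSum_coeff, Polynomial.coeff_monomial]
  rw [Finset.sum_ite_eq' (Finset.range (H.natDegree + 1)) i, if_pos (by simp; omega),
    PowerSeries.coeff_mk]
  congr

lemma natDegree_boundaryPoly [Nontrivial A] (hH : H.Monic) :
    (boundaryPoly H).natDegree = H.natDegree := by
  classical
  refine le_antisymm ?_ (le_natDegree_of_ne_zero fun h => ?_)
  · refine natDegree_sum_le_of_forall_le _ _ fun i hi => (natDegree_monomial_le _).trans ?_
    simpa [Nat.lt_succ_iff] using hi
  · have := coeff_coeff_boundaryPoly H H.natDegree 0 le_rfl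
    rw [h, Nat.cast_zero, if_pos (natDegree_mem_newtonPolygon hH), coeff_natDegree,
      hH.leadingCoeff] at this
    simp at this

lemma natDegree_quasiHomPower [Nontrivial A] {q : ℕ} (hq : 0 < q) (m : ℕ) {P : A[X]}
    (hP : P.Monic) (N : ℕ) : (quasiHomPower q m P N).natDegree = q * P.natDegree * N := by
  have hmonic : (∑ j ∈ Finset.range (P.natDegree + 1), Polynomial.monomial (q * j)
      (PowerSeries.monomial (m * (P.natDegree - j)) (P.coeff j))).Monic ∧
      (∑ j ∈ Finset.range (P.natDegree + 1), Polynomial.monomial (q * j)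
      (PowerSeries.monomial (m * (P.natDegree - j)) (P.coeff j))).natDegree
        = q * P.natDegree := by
    set f := ∑ j ∈ Finset.range (P.natDegree + 1), Polynomial.monomial (q * j)
      (PowerSeries.monomial (m * (P.natDegree - j)) (P.coeff j)) with hf
    have hle : f.natDegree ≤ q * P.natDegree := by
      refine natDegree_sum_le_of_forall_le _ _ fun i hi => (natDegree_monomial_le _).trans ?_
      exact Nat.mul_le_mul_left q (by simpa [Nat.lt_succ_iff] using hi)
    have hc : f.coeff (q * P.natDegree) = 1 := by
      simp only [hf, finsetSum_coeff, Polynomial.coeff_monomial]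
      rw [Finset.sum_eq_single P.natDegree]
      · simp [hP.leadingCoeff]
      · intro j _ hj
        rw [if_neg fun h => hj (Nat.eq_of_mul_eq_mul_left hq h)]
      · simp
    have hm := monic_of_natDegree_le_of_coeff_eq_one _ hle hc
    exact ⟨hm, le_antisymm hle (le_natDegree_of_ne_zero (by rw [hc]; exact one_ne_zero))⟩
  rw [quasiHomPower, hmonic.1.natDegree_pow, hmonic.2, mul_comm]

lemma IsEdgeData.natDegree_eq [Nontrivial A] {q m : ℕ} {P : A[X]} {N : ℕ} (hH : H.Monic)
    (h : IsEdgeData H q m P N) : H.natDegree = q * P.natDegree * N := by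
  rw [← natDegree_boundaryPoly hH, h.boundary, natDegree_quasiHomPower h.q_pos m h.monic]

/-- With `m = 0` the boundary polynomial would have value `P(0)^N`, a unit, at the origin, where a
Weierstrass polynomial of positive degree vanishes. -/
lemma IsEdgeData.pos_of_isWeierstrass [Nontrivial A] {q m : ℕ} {P : A[X]} {N : ℕ}
    (hH : IsWeierstrass H) (hN : 0 < H.natDegree) (h : IsEdgeData H q m P N) : 0 < m := by
  classical
  by_contra h0
  obtain rfl : m = 0 := by omega
  have h1 := coeff_coeff_boundaryPoly H 0 0 (Nat.zero_le _)
  rw [PowerSeries.coeff_zero_eq_constantCoeff, hH.2 0 hN, ite_self, h.boundary] at h1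
  have h2 : (quasiHomPower q 0 P N).coeff 0 = PowerSeries.C (P.coeff 0) ^ N := by
    rw [quasiHomPower, coeff_zero_eq_eval_zero, eval_pow, ← coeff_zero_eq_eval_zero]
    simp only [finsetSum_coeff, Polynomial.coeff_monomial]
    rw [Finset.sum_eq_single 0]
    · simp
    · intro j _ hj
      rw [if_neg (by simp [hj, h.q_pos.ne'])]
    · simp
  rw [h2, map_pow, constantCoeff_C] at h1
  exact (h.isUnit_coeff_zero.pow N).ne_zero h1

end NewtonPolygon

/-! ### Weierstrass division over a general coefficient ring -/

section WeierstrassDivision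

variable {B : Type u} [CommRing B]

/-- Uniqueness in Weierstrass division by `G`. -/
lemma IsWeierstrass.eq_zero_of_mul_eq {G : B⟦X⟧[X]} (hG : IsWeierstrass G) {f : B⟦X⟧⟦X⟧}
    {r : B⟦X⟧[X]} (hr : r.degree < G.natDegree) (h : (G : B⟦X⟧⟦X⟧) * f = r) : f = 0 := by
  -- The coefficient of degree `deg G + i` of `G f` is zero. It expresses `f_i` through products of
  -- other `f_j` with lower coefficients of `G`, each divisible by `x`; so divisibility by `x^k`
  -- improves to `x^(k+1)`.
  have key : ∀ k i : ℕ, (PowerSeries.X : B⟦X⟧) ^ k ∣ PowerSeries.coeff i f := by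
    intro k
    induction k with
    | zero => simp
    | succ k ih =>
      intro i
      have h1 := congrArg (PowerSeries.coeff (G.natDegree + i)) h
      rw [Polynomial.coeff_coe, Polynomial.coeff_eq_zero_of_degree_lt
        (hr.trans_le (by exact_mod_cast Nat.le_add_right _ _)), PowerSeries.coeff_mul,
        ← Finset.add_sum_erase _ _ (show (G.natDegree, i) ∈ _ by simp),
        Polynomial.coeff_coe, coeff_natDegree, hG.1.leadingCoeff, one_mul] at h1
      rw [eq_neg_of_add_eq_zero_left h1, dvd_neg]
      refine Finset.dvd_sum fun p hp => ?_
      obtain ⟨hp1, hp2⟩ := Finset.mem_erase.1 hp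
      rw [Finset.HasAntidiagonal.mem_antidiagonal] at hp2
      rw [Polynomial.coeff_coe]
      rcases lt_trichotomy p.1 G.natDegree with h2 | h2 | h2
      · rw [pow_succ']
        exact mul_dvd_mul (PowerSeries.X_dvd_iff.2 (hG.2 _ h2)) (ih _)
      · exact absurd (Prod.ext h2 (by simp only; omega)) hp1
      · rw [Polynomial.coeff_eq_zero_of_natDegree_lt h2, zero_mul]
        exact dvd_zero _
  ext i j
  simpa using PowerSeries.X_pow_dvd_iff.1 (key (j + 1) i) j (Nat.lt_succ_self j)

/-- If a polynomial is `x^w` times a Weierstrass polynomial times a unit power series, then this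
unit is a polynomial. -/
lemma IsWeierstrass.exists_eq_mul [Nontrivial B] {G p : B⟦X⟧[X]} (hG : IsWeierstrass G) {w : ℕ}
    {V : B⟦X⟧⟦X⟧} (hV : IsUnit V)
    (h : (p : B⟦X⟧⟦X⟧) = PowerSeries.C (PowerSeries.X ^ w) * (G : B⟦X⟧⟦X⟧) * V) :
    ∃ Q : B⟦X⟧[X], IsUnit (PowerSeries.constantCoeff (Q.coeff 0)) ∧
      p = Polynomial.C (PowerSeries.X ^ w) * (G * Q) := by
  have hcoeff : ∀ i, p.coeff i =
      PowerSeries.X ^ w * PowerSeries.coeff i ((G : B⟦X⟧⟦X⟧) * V) := by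
    intro i
    rw [← Polynomial.coeff_coe, h, mul_assoc, PowerSeries.coeff_C_mul]
  obtain ⟨p', rfl⟩ : Polynomial.C (PowerSeries.X ^ w) ∣ p :=
    (C_dvd_iff_dvd_coeff _ _).2 fun i => ⟨_, hcoeff i⟩
  have hp' : (p' : B⟦X⟧⟦X⟧) = (G : B⟦X⟧⟦X⟧) * V := by
    ext1 i
    rw [Polynomial.coeff_coe]
    exact PowerSeries.X_pow_mul_cancel (k := w) (by rw [← hcoeff, Polynomial.coeff_C_mul])
  have hdiv := modByMonic_add_div p' G
  -- The remainder of the Euclidean division equals `G` times (`V` minus the quotient), so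
  -- uniqueness identifies `V` with the polynomial quotient.
  have hzero : V - ((p' /ₘ G : B⟦X⟧[X]) : B⟦X⟧⟦X⟧) = 0 := by
    refine hG.eq_zero_of_mul_eq (r := p' %ₘ G) ?_ ?_
    · rw [← degree_eq_natDegree hG.1.ne_zero]
      exact degree_modByMonic_lt _ hG.1
    · rw [mul_sub, ← hp', sub_eq_iff_eq_add, ← Polynomial.coe_mul, ← Polynomial.coe_add, hdiv]
  have hVQ := sub_eq_zero.1 hzero
  refine ⟨p' /ₘ G, ?_, ?_⟩
  · rw [← Polynomial.coeff_coe, ← hVQ, PowerSeries.coeff_zero_eq_constantCoeff]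
    exact (hV.map (PowerSeries.constantCoeff (R := B⟦X⟧))).map (PowerSeries.constantCoeff (R := B))
  · congr 1
    rw [← Polynomial.coe_inj, hp', hVQ, Polynomial.coe_mul]

end WeierstrassDivision

/-! ### Functoriality of the pull-backs -/

section Pullback

variable {A B C : Type u} [CommRing A] [CommRing B] [CommRing C]

lemma substX_apply (φ : A →+* B) (a : B) {q : ℕ} (hq : q ≠ 0) (f : A⟦X⟧) :
    substX φ a q hq f = PowerSeries.expand q hq (rescale a (PowerSeries.map φ f)) := rfl

lemma pullback_apply (φ : A →+* B) (a : B) {q : ℕ} (hq : q ≠ 0) (m : ℕ) (b : B⟦X⟧)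
    (f : A⟦X⟧[X]) :
    pullback φ a q hq m b f = (f.map (substX φ a q hq)).comp
      (Polynomial.C (PowerSeries.X ^ m) * (Polynomial.X + Polynomial.C b)) := by
  rw [pullback, coe_eval₂RingHom, Polynomial.comp, eval₂_map]

lemma map_substX (ψ : B →+* C) (φ : A →+* B) (a : B) {q : ℕ} (hq : q ≠ 0) (f : A⟦X⟧) :
    PowerSeries.map ψ (substX φ a q hq f) =
      substX (RingHom.id C) (ψ a) q hq (PowerSeries.map (ψ.comp φ) f) := by
  simp only [substX_apply, PowerSeries.map_expand, ← PowerSeries.rescale_map, PowerSeries.map_id]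
  rfl

lemma map_pullback (ψ : B →+* C) (φ : A →+* B) (a : B) {q : ℕ} (hq : q ≠ 0) (m : ℕ)
    (b : B⟦X⟧) (f : A⟦X⟧[X]) :
    (pullback φ a q hq m b f).map (PowerSeries.map ψ) =
      pullback (RingHom.id C) (ψ a) q hq m (PowerSeries.map ψ b)
        (f.map (PowerSeries.map (ψ.comp φ))) := by
  simp only [pullback_apply, Polynomial.map_comp, Polynomial.map_map]
  congr 1
  · congr 1
    ext1 f
    exact map_substX ψ φ a hq f
  · simp

lemma rescale_expand (a : A) {q : ℕ} (hq : q ≠ 0) (f : A⟦X⟧) :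
    rescale a (PowerSeries.expand q hq f) = PowerSeries.expand q hq (rescale (a ^ q) f) := by
  ext i
  simp only [coeff_rescale, PowerSeries.coeff_expand]
  split_ifs with h
  · obtain ⟨j, rfl⟩ := h
    rw [Nat.mul_div_cancel_left _ (Nat.pos_of_ne_zero hq), pow_mul]
  · simp

lemma constantCoeff_substX (φ : A →+* B) (a : B) {q : ℕ} (hq : q ≠ 0) (f : A⟦X⟧) :
    PowerSeries.constantCoeff (substX φ a q hq f) = φ (PowerSeries.constantCoeff f) := by
  rw [substX_apply, PowerSeries.constantCoeff_expand, ← PowerSeries.coeff_zero_eq_constantCoeff,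
    coeff_rescale]
  simp

end Pullback

/-! ### Splitting the discriminant along an edge -/

section Dissection

variable {L : Type*} [Field L]

/-- The hypothesis says `T(y) = x^(-mN) f(x^m y)` with `N = deg f`: the roots of `T` are those of
`f` divided by `x^m`. -/
lemma monic_and_scaleRoots_eq {R : Type*} [CommRing R] {f T : R⟦X⟧[X]}
    [Nontrivial R] (hf : f.Monic) {m : ℕ}
    (h : Polynomial.C (PowerSeries.X ^ (m * f.natDegree)) * T =
      f.comp (Polynomial.C (PowerSeries.X ^ m) * Polynomial.X)) :
    T.Monic ∧ T.natDegree = f.natDegree ∧ T.scaleRoots (PowerSeries.X ^ m) = f := by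
  have hc : ∀ i, PowerSeries.X ^ (m * f.natDegree) * T.coeff i =
      f.coeff i * (PowerSeries.X ^ m) ^ i := by
    intro i
    rw [← Polynomial.coeff_C_mul, h, comp_C_mul_X_coeff]
  have hc' : ∀ i ≤ f.natDegree,
      PowerSeries.X ^ (m * (f.natDegree - i)) * T.coeff i = f.coeff i := by
    intro i hi
    apply PowerSeries.X_pow_mul_cancel (k := m * i)
    rw [← mul_assoc, ← pow_add, ← Nat.mul_add, Nat.add_sub_cancel' hi, hc, ← pow_mul, mul_comm]
  have hN : T.coeff f.natDegree = 1 := by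
    have := hc' _ le_rfl
    rwa [Nat.sub_self, mul_zero, pow_zero, one_mul, coeff_natDegree, hf.leadingCoeff] at this
  have hle : T.natDegree ≤ f.natDegree := by
    refine natDegree_le_iff_coeff_eq_zero.2 fun i hi => ?_
    apply PowerSeries.X_pow_mul_cancel (k := m * f.natDegree)
    rw [hc, Polynomial.coeff_eq_zero_of_natDegree_lt hi, zero_mul, mul_zero]
  have hdeg : T.natDegree = f.natDegree :=
    le_antisymm hle (le_natDegree_of_ne_zero (by rw [hN]; exact one_ne_zero))
  refine ⟨monic_of_natDegree_le_of_coeff_eq_one _ hle hN, hdeg, ?_⟩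
  ext1 i
  rw [coeff_scaleRoots, hdeg, ← pow_mul, mul_comm]
  rcases le_or_gt i f.natDegree with hi | hi
  · exact hc' i hi
  · rw [Polynomial.coeff_eq_zero_of_natDegree_lt hi,
      Polynomial.coeff_eq_zero_of_natDegree_lt (hle.trans_lt hi), mul_zero]

lemma exists_scaleRoots_eq {f : L⟦X⟧[X]} (hf : f.Monic) {m : ℕ}
    (h : ∀ i, PowerSeries.X ^ (m * (f.natDegree - i)) ∣ f.coeff i) :
    ∃ T : L⟦X⟧[X], T.Monic ∧ T.natDegree = f.natDegree ∧
      T.scaleRoots (PowerSeries.X ^ m) = f := by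
  have hdvd : Polynomial.C ((PowerSeries.X : L⟦X⟧) ^ (m * f.natDegree)) ∣
      f.comp (Polynomial.C (PowerSeries.X ^ m) * Polynomial.X) := by
    refine (C_dvd_iff_dvd_coeff _ _).2 fun i => ?_
    rw [comp_C_mul_X_coeff]
    rcases le_or_gt i f.natDegree with hi | hi
    · obtain ⟨c, hc⟩ := h i
      refine ⟨c, ?_⟩
      rw [hc, ← Nat.sub_add_cancel hi, Nat.mul_add, pow_add, ← pow_mul, Nat.sub_add_cancel hi]
      ring
    · rw [Polynomial.coeff_eq_zero_of_natDegree_lt hi, zero_mul]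
      exact dvd_zero _
  obtain ⟨T, hT⟩ := hdvd
  exact ⟨T, monic_and_scaleRoots_eq hf hT.symm⟩

/-- Two computations of the discriminant of `h(x^q, y)`: ramification multiplies the order by `q`,
and multiplying the `N` roots of `T` by `x^m` adds `N (N - 1) m`. -/
lemma smul_discrOrder_eq {h T : L⟦X⟧[X]} (hh : h.Monic) (hT : T.Monic) {q m : ℕ} (hq : q ≠ 0)
    (hn : (h.natDegree : L) ≠ 0) (hdeg : T.natDegree = h.natDegree)
    (hTh : T.scaleRoots (PowerSeries.X ^ m) = h.map
      ((PowerSeries.expand q hq : L⟦X⟧ →ₐ[L] L⟦X⟧) : L⟦X⟧ →+* L⟦X⟧)) :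
    q * discrOrder h = ((h.natDegree * (h.natDegree - 1) * m : ℕ) : ℕ∞) + discrOrder T := by
  have := discrOrder_map_expand hq hh
  rw [← hTh, discrOrder_scaleRoots hT (by rwa [hdeg]), order_X_pow, hdeg] at this
  rw [nsmul_eq_mul, nsmul_eq_mul] at this
  rw [← this]
  push_cast
  rfl

/-- If all the monomials of `h` lie on or above the line of slope `-m/q` through
`(deg h, 0)`, then `ord disc h ≥ deg h (deg h - 1) m/q`. -/
lemma le_smul_discrOrder {h : L⟦X⟧[X]} (hh : h.Monic) {q m : ℕ} (hq : q ≠ 0)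
    (hn : (h.natDegree : L) ≠ 0)
    (hline : ∀ i, ((m * (h.natDegree - i) : ℕ) : ℕ∞) ≤ q * (h.coeff i).order) :
    ((h.natDegree * (h.natDegree - 1) * m : ℕ) : ℕ∞) ≤ q * discrOrder h := by
  set ε := ((PowerSeries.expand q hq : L⟦X⟧ →ₐ[L] L⟦X⟧) : L⟦X⟧ →+* L⟦X⟧) with hε
  obtain ⟨T, hT, hdeg, hTh⟩ := exists_scaleRoots_eq (m := m) (hh.map ε) fun i => by
    rw [hh.natDegree_map, Polynomial.coeff_map, PowerSeries.X_pow_dvd_iff]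
    intro j hj
    apply coeff_of_lt_order
    rw [hε, RingHom.coe_coe, order_expand, nsmul_eq_mul]
    exact lt_of_lt_of_le (by exact_mod_cast hj) (hline i)
  rw [smul_discrOrder_eq hh hT hq hn (by rw [hdeg, hh.natDegree_map]) hTh]
  exact le_self_add

lemma scaleRoots_eq_comp (f : L⟦X⟧[X]) {a : L} (ha : a ≠ 0) :
    f.scaleRoots (PowerSeries.C a) = Polynomial.C (PowerSeries.C (a ^ f.natDegree)) *
      f.comp (Polynomial.C (PowerSeries.C a⁻¹) * Polynomial.X) := by
  ext1 i
  rw [coeff_scaleRoots, Polynomial.coeff_C_mul, comp_C_mul_X_coeff, ← map_pow, ← map_pow]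
  rcases le_or_gt i f.natDegree with hi | hi
  · rw [mul_left_comm, ← map_mul]
    congr 2
    rw [inv_pow, eq_mul_inv_iff_mul_eq₀ (pow_ne_zero _ ha), ← pow_add, Nat.sub_add_cancel hi]
  · rw [Polynomial.coeff_eq_zero_of_natDegree_lt hi]
    simp

lemma IsWeierstrass.map_constantCoeff {A : Type*} [CommRing A] {G : A⟦X⟧[X]} (hG : IsWeierstrass G) :
    G.map (PowerSeries.constantCoeff (R := A)) = Polynomial.X ^ G.natDegree := by
  ext i
  rw [Polynomial.coeff_map, Polynomial.coeff_X_pow]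
  rcases lt_trichotomy i G.natDegree with h | h | h
  · rw [hG.2 i h, if_neg h.ne]
  · rw [h, coeff_natDegree, hG.1.leadingCoeff, if_pos rfl, map_one]
  · rw [Polynomial.coeff_eq_zero_of_natDegree_lt h, if_neg h.ne', map_zero]

/-- `g(λx, λ^{-m}(y - w))`, made monic, where `λ = w^{-t}`. -/
noncomputable def twist (m t : ℕ) (w : L) (g : L⟦X⟧[X]) : L⟦X⟧[X] :=
  ((g.map (rescale ((w ^ t)⁻¹))).scaleRoots (PowerSeries.C (((w ^ t)⁻¹) ^ m))).taylor
    (-PowerSeries.C w)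

variable {g : L⟦X⟧[X]}

lemma monic_twist (hg : g.Monic) (m t : ℕ) (w : L) : (twist m t w g).Monic := by
  rw [twist, Polynomial.Monic, leadingCoeff_taylor]
  exact (monic_scaleRoots_iff _).2 (hg.map _)

lemma natDegree_twist (hg : g.Monic) (m t : ℕ) (w : L) :
    (twist m t w g).natDegree = g.natDegree := by
  rw [twist, natDegree_taylor, natDegree_scaleRoots, hg.natDegree_map]

lemma discrOrder_twist (hg : g.Monic) (hn : (g.natDegree : L) ≠ 0) (m t : ℕ) {w : L}
    (hw : w ≠ 0) : discrOrder (twist m t w g) = discrOrder g := by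
  have h0 : (w ^ t)⁻¹ ≠ 0 := inv_ne_zero (pow_ne_zero _ hw)
  rw [twist, discrOrder_taylor, discrOrder_scaleRoots (hg.map _) (by rwa [hg.natDegree_map]),
    discrOrder_map_rescale h0 hg, order_zero_of_unit, smul_zero, zero_add]
  exact ((IsUnit.mk0 _ h0).pow m).map PowerSeries.C

lemma map_constantCoeff_twist (hg : IsWeierstrass g) (m t : ℕ) (w : L) :
    (twist m t w g).map (PowerSeries.constantCoeff (R := L)) =
      (Polynomial.X - Polynomial.C w) ^ g.natDegree := by
  have h2 : (g.map (rescale ((w ^ t)⁻¹))).map (PowerSeries.constantCoeff (R := L)) =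
      Polynomial.X ^ g.natDegree := by
    rw [← hg.map_constantCoeff, Polynomial.map_map]
    congr 1
    ext f
    rw [RingHom.comp_apply, ← PowerSeries.coeff_zero_eq_constantCoeff, coeff_rescale]
    simp
  have hdeg : ((g.map (rescale ((w ^ t)⁻¹))).scaleRoots
      (PowerSeries.C (((w ^ t)⁻¹) ^ m))).map (PowerSeries.constantCoeff (R := L)) =
      Polynomial.X ^ g.natDegree := by
    rw [map_scaleRoots _ _ _ (by rw [(hg.1.map _).leadingCoeff]; simp), h2]
    ext i
    rw [coeff_scaleRoots, natDegree_X_pow, Polynomial.coeff_X_pow]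
    split_ifs with h
    · simp [h]
    · simp
  rw [twist, map_taylor, hdeg, taylor_X_pow]
  simp [sub_eq_add_neg]

/-- Put `z = w^q` and `λ = w^(-t)`. Replacing `x` by `λ x` turns `z^t x^q` into `x^q` and, as `q s =
t m + 1`, turns `x^m (y + z^s)` into `x^m (λ^m y + w)`. Replacing `y` by `λ^(-m) (y - w)` then
leaves `(x^q, x^m y)`, which no longer depends on `w`; so the twists for all `w` divide one and the
same polynomial. -/
lemma exists_mul_twist {h Q : L⟦X⟧[X]} {q : ℕ} (hq : q ≠ 0) {m s t n : ℕ}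
    (hst : q * s = t * m + 1) {w : L} (hw : w ≠ 0)
    (heq : pullback (RingHom.id L) ((w ^ q) ^ t) q hq m (PowerSeries.C ((w ^ q) ^ s)) h =
      Polynomial.C (PowerSeries.X ^ n) * (g * Q)) :
    ∃ c, Polynomial.C (PowerSeries.X ^ n) * (twist m t w g * c) =
      (h.map ((PowerSeries.expand q hq : L⟦X⟧ →ₐ[L] L⟦X⟧) : L⟦X⟧ →+* L⟦X⟧)).comp
        (Polynomial.C (PowerSeries.X ^ m) * Polynomial.X) := by
  set l := (w ^ t)⁻¹ with hl
  have hl0 : l ≠ 0 := inv_ne_zero (pow_ne_zero _ hw)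
  have hm0 : l ^ m ≠ 0 := pow_ne_zero _ hl0
  have hlz : l ^ q * (w ^ q) ^ t = 1 := by
    rw [hl, ← pow_mul, mul_comm q t, pow_mul, ← mul_pow, inv_mul_cancel₀ (pow_ne_zero _ hw),
      one_pow]
  have hlw : l ^ m * (w ^ q) ^ s = w := by
    rw [← pow_mul, hst, pow_succ, pow_mul, hl, ← mul_assoc, ← mul_pow,
      inv_mul_cancel₀ (pow_ne_zero _ hw), one_pow, one_mul]
  rw [pullback_apply] at heq
  have h1 := congrArg (Polynomial.map (rescale l)) heq
  rw [Polynomial.map_comp, Polynomial.map_map] at h1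
  conv_rhs at h1 => rw [Polynomial.map_mul, Polynomial.map_mul]
  have h2 : (rescale l).comp (substX (RingHom.id L) ((w ^ q) ^ t) q hq) =
      ((PowerSeries.expand q hq : L⟦X⟧ →ₐ[L] L⟦X⟧) : L⟦X⟧ →+* L⟦X⟧) := by
    ext1 f
    rw [RingHom.comp_apply, substX_apply, rescale_expand, PowerSeries.map_id, RingHom.coe_coe,
      id_eq, rescale_rescale, mul_comm, hlz, rescale_one, RingHom.id_apply]
  rw [h2] at h1
  set ε := ((PowerSeries.expand q hq : L⟦X⟧ →ₐ[L] L⟦X⟧) : L⟦X⟧ →+* L⟦X⟧)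
  set p : L⟦X⟧[X] := Polynomial.C (PowerSeries.C (l ^ m)⁻¹) *
    (Polynomial.X + Polynomial.C (-PowerSeries.C w)) with hp
  have h3 := congrArg (fun f => f.comp p) h1
  simp only [Polynomial.mul_comp, Polynomial.comp_assoc] at h3
  have h4 : ((Polynomial.C (PowerSeries.X ^ m) * (Polynomial.X +
      Polynomial.C (PowerSeries.C ((w ^ q) ^ s))) : L⟦X⟧[X]).map (rescale l)).comp p =
      Polynomial.C (PowerSeries.X ^ m) * Polynomial.X := by
    have hC : (rescale l) (PowerSeries.C ((w ^ q) ^ s)) = PowerSeries.C ((w ^ q) ^ s) := by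
      ext i
      rw [coeff_rescale, PowerSeries.coeff_C]
      split_ifs with hi
      · simp [hi]
      · simp
    rw [Polynomial.map_mul, Polynomial.map_add, Polynomial.map_C, Polynomial.map_C,
      Polynomial.map_X, hC, map_pow, rescale_X, mul_pow, ← map_pow, Polynomial.mul_comp,
      Polynomial.add_comp, Polynomial.C_comp, Polynomial.C_comp, Polynomial.X_comp, hp]
    have e1 : (Polynomial.C (PowerSeries.C (l ^ m)) * Polynomial.C (PowerSeries.C (l ^ m)⁻¹) :
        L⟦X⟧[X]) = 1 := by
      rw [← map_mul, ← map_mul, mul_inv_cancel₀ hm0, map_one, map_one]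
    have e2 : (Polynomial.C (PowerSeries.C (l ^ m)) * Polynomial.C (PowerSeries.C ((w ^ q) ^ s)) :
        L⟦X⟧[X]) = Polynomial.C (PowerSeries.C w) := by
      rw [← map_mul, ← map_mul, hlw]
    rw [map_mul, map_neg]
    linear_combination (Polynomial.C (PowerSeries.X ^ m) * (Polynomial.X -
      Polynomial.C (PowerSeries.C w))) * e1 + Polynomial.C (PowerSeries.X ^ m) * e2
  rw [h4] at h3
  have h5 : twist m t w g = Polynomial.C (PowerSeries.C ((l ^ m) ^ (g.map (rescale l)).natDegree)) *
      (g.map (rescale l)).comp p := by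
    rw [twist, ← hl, scaleRoots_eq_comp _ hm0, taylor_apply, Polynomial.mul_comp,
      Polynomial.C_comp, Polynomial.comp_assoc]
    simp [hp]
  rw [h3, h5]
  set k := (g.map (rescale l)).natDegree
  refine ⟨Polynomial.C (PowerSeries.C ((l ^ m) ^ k)⁻¹) * (Polynomial.C (PowerSeries.C (l ^ n)) *
    (Q.map (rescale l)).comp p), ?_⟩
  have e3 : (Polynomial.C (PowerSeries.C ((l ^ m) ^ k)) *
      Polynomial.C (PowerSeries.C ((l ^ m) ^ k)⁻¹) : L⟦X⟧[X]) = 1 := by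
    rw [← map_mul, ← map_mul, mul_inv_cancel₀ (pow_ne_zero _ hm0), map_one, map_one]
  rw [Polynomial.map_C, Polynomial.C_comp, map_pow (rescale l), rescale_X, mul_pow, ← map_pow,
    map_mul]
  linear_combination (Polynomial.C (PowerSeries.C (l ^ n)) * Polynomial.C (PowerSeries.X ^ n) *
    (g.map (rescale l)).comp p * (Q.map (rescale l)).comp p) * e3

/-- The discriminant of `h` in terms of those of the transforms of `h` at the roots `z i` of the
polynomial attached to an edge of slope `-m/q`. -/
lemma smul_discrOrder_eq_sum [IsAlgClosed L] {ι : Type*} [Fintype ι] {h : L⟦X⟧[X]}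
    (hh : h.Monic) {q : ℕ} (hq : q ≠ 0) {m s t N : ℕ} (hst : q * s = t * m + 1)
    (hn : (h.natDegree : L) ≠ 0) (hdeg : h.natDegree = q * Fintype.card ι * N)
    {z : ι → L} (hz : Function.Injective z) (hz0 : ∀ i, z i ≠ 0) {G Q : ι → L⟦X⟧[X]}
    (hG : ∀ i, IsWeierstrass (G i)) (hGN : ∀ i, (G i).natDegree = N)
    (heq : ∀ i, pullback (RingHom.id L) (z i ^ t) q hq m (PowerSeries.C (z i ^ s)) h =
      Polynomial.C (PowerSeries.X ^ (m * h.natDegree)) * (G i * Q i)) :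
    q * discrOrder h = ((h.natDegree * (h.natDegree - 1) * m : ℕ) : ℕ∞) +
      q * ∑ i, discrOrder (G i) := by
  classical
  rw [hdeg] at hn
  push_cast at hn
  -- The degree `q · card ι · N` is nonzero in `L`, hence so is each factor: `q` for the
  -- separability of `w^q = z i`, and `N` for the discriminants of the twists.
  have hqL : (q : L) ≠ 0 := left_ne_zero_of_mul (left_ne_zero_of_mul hn)
  have hNL : (N : L) ≠ 0 := right_ne_zero_of_mul hn
  have hcardL := right_ne_zero_of_mul (left_ne_zero_of_mul hn)
  set W : Finset (Σ _ : ι, L) := Finset.univ.sigma fun i => (nthRoots q (z i)).toFinset with hW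
  have hcard : ∀ i, (nthRoots q (z i)).toFinset.card = q := by
    intro i
    have hsep := separable_X_pow_sub_C (z i) hqL (hz0 i)
    rw [nthRoots, Multiset.toFinset_card_of_nodup (nodup_roots hsep),
      ← (IsAlgClosed.splits _).natDegree_eq_card_roots, natDegree_X_pow_sub_C]
  have hmem : ∀ a ∈ W, a.2 ^ q = z a.1 := by
    intro a ha
    rw [hW, Finset.mem_sigma, Multiset.mem_toFinset, mem_nthRoots (Nat.pos_of_ne_zero hq)] at ha
    exact ha.2
  have hne : ∀ a ∈ W, a.2 ≠ 0 := by
    intro a ha h0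
    have := hmem a ha
    rw [h0, zero_pow hq] at this
    exact hz0 _ this.symm
  have hinj : ∀ a ∈ W, ∀ b ∈ W, a.2 = b.2 → a = b := by
    rintro ⟨i, a⟩ ha ⟨j, b⟩ hb (rfl : a = b)
    obtain rfl : i = j := hz ((hmem ⟨i, a⟩ ha).symm.trans (hmem ⟨j, a⟩ hb))
    rfl
  have hex : ∀ a ∈ W, ∃ c, Polynomial.C (PowerSeries.X ^ (m * h.natDegree)) *
      (twist m t a.2 (G a.1) * c) =
      (h.map ((PowerSeries.expand q hq : L⟦X⟧ →ₐ[L] L⟦X⟧) : L⟦X⟧ →+* L⟦X⟧)).comp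
        (Polynomial.C (PowerSeries.X ^ m) * Polynomial.X) := by
    intro a ha
    refine exists_mul_twist hq hst (hne a ha) (Q := Q a.1) ?_
    rw [hmem a ha]
    exact heq a.1
  obtain ⟨i₀⟩ : Nonempty ι := by
    by_contra hι
    rw [not_nonempty_iff] at hι
    exact hcardL (by simp)
  obtain ⟨w₀, hw₀⟩ : (nthRoots q (z i₀)).toFinset.Nonempty := by
    rw [← Finset.card_pos, hcard]; exact Nat.pos_of_ne_zero hq
  obtain ⟨c₀, hc₀⟩ := hex ⟨i₀, w₀⟩ (by simpa [hW] using hw₀)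
  set T := twist m t w₀ (G i₀) * c₀ with hT
  set ε := ((PowerSeries.expand q hq : L⟦X⟧ →ₐ[L] L⟦X⟧) : L⟦X⟧ →+* L⟦X⟧) with hε
  obtain ⟨hTm, hTdeg, hTh⟩ := monic_and_scaleRoots_eq (hh.map ε) (m := m) (T := T)
    (by rw [hh.natDegree_map]; exact hc₀)
  rw [hh.natDegree_map] at hTdeg
  have hdvd : ∀ a ∈ W, twist m t a.2 (G a.1) ∣ T := by
    intro a ha
    obtain ⟨c, hc⟩ := hex a ha
    refine ⟨c, mul_left_cancel₀ ?_ (hc₀.trans hc.symm)⟩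
    exact Polynomial.C_ne_zero.2 (pow_ne_zero _ PowerSeries.X_ne_zero)
  -- At `x = 0` the twists become powers of `y - w` with distinct `w`.
  have hcop : (W : Set (Σ _ : ι, L)).Pairwise
      (Function.onFun IsCoprime fun a => twist m t a.2 (G a.1)) := by
    intro a ha b hb hab
    refine isCoprime_of_map_constantCoeff (monic_twist (hG _).1 _ _ _) ?_
    rw [map_constantCoeff_twist (hG _), map_constantCoeff_twist (hG _)]
    exact (isCoprime_X_sub_C_of_isUnit_sub
      (sub_ne_zero.2 fun h => hab (hinj a ha b hb h)).isUnit).pow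
  have hprod : T = ∏ a ∈ W, twist m t a.2 (G a.1) := by
    have hmon := monic_prod_of_monic W (fun a => twist m t a.2 (G a.1))
      fun a _ => monic_twist (hG _).1 _ _ _
    -- The product of the coprime divisors divides `T`; the degrees agree because there are `q ·
    -- card ι` values of `w`, each contributing `N`.
    refine (eq_of_monic_of_dvd_of_natDegree_le hmon hTm
      (Finset.prod_dvd_of_coprime hcop hdvd) ?_)
    rw [natDegree_prod_of_monic _ _ fun a _ => monic_twist (hG _).1 _ _ _, hTdeg, hdeg,
      Finset.sum_congr rfl fun a _ => (natDegree_twist (hG a.1).1 m t a.2).trans (hGN a.1),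
      Finset.sum_const, hW, Finset.card_sigma, Finset.sum_congr rfl fun i _ => hcard i]
    simp [mul_comm]
  rw [smul_discrOrder_eq hh hTm hq (by rw [hdeg]; push_cast; exact hn) hTdeg hTh, hprod,
    discrOrder_prod _ _ (fun a _ => monic_twist (hG _).1 _ _ _) hcop,
    Finset.sum_congr rfl fun a ha =>
      discrOrder_twist (hG a.1).1 (by rwa [hGN]) m t (hne a ha), hW, Finset.sum_sigma]
  simp only [Finset.sum_const, hcard, nsmul_eq_mul, Finset.mul_sum]

end Dissection

/-! ### The shift killing the subleading term, and values at the origin -/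

section Depress

variable {A B : Type u} [CommRing A] [CommRing B]

lemma isWeierstrass_of_map_constantCoeff {G : A⟦X⟧[X]} (hG : G.Monic)
    (h : G.map (PowerSeries.constantCoeff (R := A)) = Polynomial.X ^ G.natDegree) :
    IsWeierstrass G := by
  refine ⟨hG, fun i hi => ?_⟩
  rw [← Polynomial.coeff_map, h, Polynomial.coeff_X_pow, if_neg hi.ne]

lemma IsWeierstrass.map [Nontrivial B] {G : A⟦X⟧[X]} (hG : IsWeierstrass G) (φ : A →+* B) :
    IsWeierstrass (G.map (PowerSeries.map φ)) := by
  refine ⟨hG.1.map _, fun i hi => ?_⟩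
  rw [hG.1.natDegree_map] at hi
  rw [Polynomial.coeff_map, ← PowerSeries.coeff_zero_eq_constantCoeff, PowerSeries.coeff_map,
    PowerSeries.coeff_zero_eq_constantCoeff, hG.2 i hi, map_zero]

lemma depress_eq_taylor (G : A⟦X⟧[X]) : depress G = G.taylor (shift G) := rfl

lemma monic_depress {G : A⟦X⟧[X]} (hG : G.Monic) : (depress G).Monic := by
  rw [depress_eq_taylor, Polynomial.Monic, leadingCoeff_taylor]
  exact hG

lemma natDegree_depress (G : A⟦X⟧[X]) : (depress G).natDegree = G.natDegree := by
  rw [depress_eq_taylor, natDegree_taylor]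

lemma depress_eq_X {G : A⟦X⟧[X]} (hG : G.Monic) (h : G.natDegree = 1) :
    depress G = Polynomial.X := by
  have h1 : G = Polynomial.X + Polynomial.C (G.coeff 0) := by
    conv_lhs => rw [G.eq_X_add_C_of_natDegree_le_one h.le]
    rw [← h, coeff_natDegree, hG.leadingCoeff, map_one, one_mul]
  have h2 : shift G = -G.coeff 0 := by
    rw [shift, h]; simp
  rw [depress, h2]
  nth_rw 1 [h1]
  simp

lemma constantCoeff_shift {G : A⟦X⟧[X]} (hG : IsWeierstrass G) (hN : 0 < G.natDegree) :
    PowerSeries.constantCoeff (shift G) = 0 := by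
  rw [shift, map_neg, map_mul, hG.2 _ (by omega), mul_zero, neg_zero]

lemma IsWeierstrass.depress {G : A⟦X⟧[X]} (hG : IsWeierstrass G) (hN : 0 < G.natDegree) :
    IsWeierstrass (depress G) := by
  refine isWeierstrass_of_map_constantCoeff (monic_depress hG.1) ?_
  rw [natDegree_depress, depress_eq_taylor, map_taylor, constantCoeff_shift hG hN, taylor_zero,
    hG.map_constantCoeff]

lemma discrOrder_map_depress {L : Type*} [Field L] (φ : A →+* L) (G : A⟦X⟧[X]) :
    discrOrder ((depress G).map (PowerSeries.map φ)) =
      discrOrder (G.map (PowerSeries.map φ)) := by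
  rw [depress_eq_taylor, map_taylor, discrOrder_taylor]

lemma constantCoeff_coeff_zero_comp (p r : A⟦X⟧[X])
    (hr : PowerSeries.constantCoeff (r.coeff 0) = 0) :
    PowerSeries.constantCoeff ((p.comp r).coeff 0) = PowerSeries.constantCoeff (p.coeff 0) := by
  have h : ∀ p : A⟦X⟧[X], PowerSeries.constantCoeff (p.coeff 0) =
      (p.map (PowerSeries.constantCoeff (R := A))).eval 0 := by
    intro p; rw [← coeff_zero_eq_eval_zero, Polynomial.coeff_map]
  rw [h, Polynomial.map_comp, eval_comp, ← h, hr, ← h]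

/-- For `m > 0` the substitution sends the origin to the origin whatever `b` is, so units at the
origin stay units. -/
lemma constantCoeff_coeff_zero_pullback (φ : A →+* B) (a : B) {q : ℕ} (hq : q ≠ 0) {m : ℕ}
    (hm : 0 < m) (b : B⟦X⟧) (U : A⟦X⟧[X]) :
    PowerSeries.constantCoeff ((pullback φ a q hq m b U).coeff 0) =
      φ (PowerSeries.constantCoeff (U.coeff 0)) := by
  rw [pullback_apply, constantCoeff_coeff_zero_comp, Polynomial.coeff_map, constantCoeff_substX]
  rw [Polynomial.mul_coeff_zero, Polynomial.coeff_C_zero, map_mul, map_pow,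
    PowerSeries.constantCoeff_X, zero_pow hm.ne', zero_mul]

lemma pullback_add (φ : A →+* B) (a : B) {q : ℕ} (hq : q ≠ 0) (m : ℕ) (b c : B⟦X⟧)
    (U : A⟦X⟧[X]) :
    pullback φ a q hq m (b + c) U = (pullback φ a q hq m b U).taylor c := by
  rw [pullback_apply, pullback_apply, taylor_apply, Polynomial.comp_assoc]
  congr 1
  simp
  ring

lemma pullback_C_X_pow (φ : A →+* B) (a : B) {q : ℕ} (hq : q ≠ 0) (m : ℕ) (b : B⟦X⟧) (v : ℕ) :
    pullback φ a q hq m b (Polynomial.C (PowerSeries.X ^ v)) =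
      Polynomial.C (PowerSeries.X ^ (q * v)) * Polynomial.C (PowerSeries.C (a ^ v)) := by
  rw [pullback_apply, Polynomial.map_C, Polynomial.C_comp, map_pow, substX_apply,
    PowerSeries.map_X, rescale_X, map_mul, PowerSeries.expand_C, PowerSeries.expand_X, mul_pow,
    ← pow_mul, map_pow PowerSeries.C, mul_comm, map_mul]

end Depress

/-! ### Geometric points of the residue rings -/

section Points

variable {A : Type u} [CommRing A]

lemma isUnit_root_of_isUnit_coeff_zero {P : A[X]} (h : IsUnit (P.coeff 0)) :
    IsUnit (AdjoinRoot.root P) := by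
  have h1 : AdjoinRoot.root P * AdjoinRoot.mk P P.divX = -AdjoinRoot.of P (P.coeff 0) := by
    rw [eq_neg_iff_add_eq_zero, ← AdjoinRoot.mk_X, ← AdjoinRoot.mk_C, ← map_mul, ← map_add,
      X_mul_divX_add, AdjoinRoot.mk_self]
  exact isUnit_of_mul_isUnit_left (h1 ▸ (h.map (AdjoinRoot.of P)).neg)

/-- The image of `φ` is a domain integral over the field `K`, hence a field, and it is perfect as an
algebraic extension of `K`. There square-free means separable, which survives the extension to `L`.
-/
lemma separable_map_of_squarefreeOver {K L : Type*} [Field K] [PerfectField K] [Field L]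
    {ι : K →+* A} (hι : ι.IsIntegral) (φ : A →+* L) {P : A[X]} (hP : SquarefreeOver P) :
    (P.map φ).Separable := by
  let := ι.toAlgebra
  have : Algebra.IsIntegral K A := ⟨hι⟩
  have : (RingHom.ker φ).IsPrime := RingHom.ker_isPrime φ
  have hfield : IsField (A ⧸ RingHom.ker φ) :=
    isField_of_isIntegral_of_isField' (R := K) (Field.toIsField K)
  have hmax : (RingHom.ker φ).IsMaximal := Ideal.Quotient.maximal_of_isField _ hfield
  let := Ideal.Quotient.field (RingHom.ker φ)
  have : PerfectField (A ⧸ RingHom.ker φ) := Algebra.IsAlgebraic.perfectField (K := K)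
  have hsep := PerfectField.separable_iff_squarefree.2 (hP _ hmax)
  have := hsep.map (f := RingHom.kerLift φ)
  rwa [Polynomial.map_map, show (RingHom.kerLift φ).comp (Ideal.Quotient.mk _) = φ from
    RingHom.ext fun a => RingHom.kerLift_mk φ a] at this

lemma isIntegral_comp_of {K : Type*} [Field K] {ι : K →+* A} (hι : ι.IsIntegral) {P : A[X]}
    (hP : P.Monic) : ((AdjoinRoot.of P).comp ι).IsIntegral :=
  RingHom.IsIntegral.trans _ _ hι (by
    have := hP.finite_adjoinRoot
    exact (algebraMap_isIntegral_iff (R := A) (A := AdjoinRoot P)).2 inferInstance)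

/-- The step of the sequence at a geometric point `φ` of the residue ring. -/
lemma exists_points_adjoinRoot {K : Type*} {L : Type u} [Field K] [PerfectField K] [Field L]
    [IsAlgClosed L] {ι : K →+* A} (hι : ι.IsIntegral) (φ : A →+* L) {H : A⟦X⟧[X]} (hH : H.Monic)
    (hn : (H.natDegree : L) ≠ 0) {q m N : ℕ} {P : A[X]} (hedge : IsEdgeData H q m P N) {s t : ℕ}
    (hst : q * s = t * m + 1) {G Q : (AdjoinRoot P)⟦X⟧[X]} (hG : IsWeierstrass G)
    (hGN : G.natDegree = N)
    (hQ : pullback (AdjoinRoot.of P) (AdjoinRoot.root P ^ t) q hedge.q_pos.ne' m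
        (PowerSeries.C (AdjoinRoot.root P ^ s)) H =
      Polynomial.C (PowerSeries.X ^ (m * H.natDegree)) * (G * Q)) :
    ∃ Ψ : Multiset (AdjoinRoot P →+* L), Ψ.card = P.natDegree ∧
      q * discrOrder (H.map (PowerSeries.map φ)) =
        ((H.natDegree * (H.natDegree - 1) * m : ℕ) : ℕ∞) +
          q * (Ψ.map fun ψ => discrOrder (G.map (PowerSeries.map ψ))).sum := by
  classical
  have : Nontrivial A := φ.domain_nontrivial
  -- The points of `AdjoinRoot P` above `φ` correspond to these roots; separability makes their
  -- number exactly `deg P`.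
  set I := {z // z ∈ (P.map φ).roots.toFinset}
  have hroot : ∀ i : I, P.eval₂ φ i.1 = 0 := fun i => by
    have := (mem_roots'.1 (Multiset.mem_toFinset.1 i.2)).2
    rwa [Polynomial.IsRoot, eval_map] at this
  set ψ : I → (AdjoinRoot P →+* L) := fun i => AdjoinRoot.lift φ i.1 (hroot i) with hψ
  have hψr : ∀ i, ψ i (AdjoinRoot.root P) = i.1 := fun i => AdjoinRoot.lift_root (hroot i)
  have hψo : ∀ i, (ψ i).comp (AdjoinRoot.of P) = φ := fun i => AdjoinRoot.lift_comp_of (hroot i)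
  have hcard : Fintype.card I = P.natDegree := by
    rw [Fintype.card_coe, Multiset.toFinset_card_of_nodup
      (nodup_roots (separable_map_of_squarefreeOver hι φ hedge.squarefree)),
      ← (IsAlgClosed.splits _).natDegree_eq_card_roots, hedge.monic.natDegree_map]
  have hdegH : (H.map (PowerSeries.map φ)).natDegree = H.natDegree := hH.natDegree_map _
  refine ⟨Finset.univ.val.map ψ, by simp [hcard], ?_⟩
  rw [Multiset.map_map]
  have key := smul_discrOrder_eq_sum (ι := I) (hH.map (PowerSeries.map φ)) hedge.q_pos.ne'
    (m := m) (N := N) hst (by rwa [hdegH])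
    (by rw [hdegH, hcard]; exact hedge.natDegree_eq hH) (z := Subtype.val)
    Subtype.val_injective
    (fun i => by
      rw [← hψr]
      exact ((isUnit_root_of_isUnit_coeff_zero hedge.isUnit_coeff_zero).map (ψ i)).ne_zero)
    (G := fun i => G.map (PowerSeries.map (ψ i))) (Q := fun i => Q.map (PowerSeries.map (ψ i)))
    (fun i => hG.map _) (fun i => by rw [hG.1.natDegree_map, hGN])
    (fun i => by
      have := congrArg (Polynomial.map (PowerSeries.map (ψ i))) hQ
      rw [map_pullback, hψo, PowerSeries.map_C, map_pow (ψ i), map_pow (ψ i), hψr, Polynomial.map_mul,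
        Polynomial.map_mul, Polynomial.map_C, map_pow (PowerSeries.map _),
        PowerSeries.map_X] at this
      rw [this, hdegH])
  rw [hdegH] at key
  exact key

end Points

/-! ### Reading off the valuation -/

section Valuation

variable {A : Type u} [CommRing A]

/-- Modulo `x` the product `H U` is nonzero: `U` is nonzero there, and the monic `H` is not a zero
divisor even though `A` may have some. -/
lemma val_eq [Nontrivial A] {H U : A⟦X⟧[X]} (hH : H.Monic) {v : ℕ}
    (hU : IsUnit (PowerSeries.constantCoeff (U.coeff 0))) :
    val (Polynomial.C (PowerSeries.X ^ v) * (H * U)) = v := by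
  have hne : (H * U).map (PowerSeries.constantCoeff (R := A)) ≠ 0 := by
    rw [Polynomial.map_mul]
    refine (hH.map _).mul_right_ne_zero fun h => hU.ne_zero ?_
    rw [← Polynomial.coeff_map, h, Polynomial.coeff_zero]
  obtain ⟨i, hi⟩ : ∃ i, PowerSeries.constantCoeff ((H * U).coeff i) ≠ 0 := by
    by_contra hcon
    push Not at hcon
    exact hne (Polynomial.ext fun i => by rw [Polynomial.coeff_map, hcon, Polynomial.coeff_zero])
  refine le_antisymm ((iInf_le _ i).trans (order_le _ ?_)) (le_iInf fun j => ?_)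
  · rw [Polynomial.coeff_C_mul, PowerSeries.coeff_X_pow_mul', if_pos le_rfl, Nat.sub_self]
    exact (PowerSeries.coeff_zero_eq_constantCoeff_apply _).trans_ne hi
  · refine nat_le_order _ _ fun k hk => ?_
    rw [Polynomial.coeff_C_mul, PowerSeries.coeff_X_pow_mul', if_neg (by omega)]

end Valuation

/-! ### The invariant along the sequence and the bounds on `η_k` -/

section Sequence

variable {K : Type u} [Field K]

/-- What is known of the ring `A = K_k`, of `H = H_k`, of `e = e_k` and of `Fk = π_k^* F`, in terms
of the degree `d` of `F` and of the valuation `δ` of its discriminant. The multiset `Φ` consists of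
the geometric points of `A`. -/
structure IsBalanced (K : Type u) [Field K] (d δ : ℕ) {A : Type u} [CommRing A] (H : A⟦X⟧[X])
    (e : ℕ) (Fk : A⟦X⟧[X]) : Prop where
  isIntegral : ∃ ι : K →+* A, ι.IsIntegral
  monic : H.Monic
  pos : 0 < H.natDegree
  eq_X : H.natDegree = 1 → H = Polynomial.X
  e_pos : 0 < e
  exists_points : ∃ (v : ℕ) (U : A⟦X⟧[X]) (Φ : Multiset (A →+* AlgebraicClosure K))
    (D : ℕ) (T : ℝ),
    Fk = Polynomial.C (PowerSeries.X ^ v) * (H * U) ∧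
    (U = 1 ∨ IsWeierstrass H ∧ IsUnit (PowerSeries.constantCoeff (U.coeff 0))) ∧
    e * Φ.card * H.natDegree = d ∧
    (Φ.map fun φ => discrOrder (H.map (PowerSeries.map φ))).sum = D ∧
    (δ : ℝ) = D + T ∧ T ≤ d * (v / e) ∧ d * (v / e) ≤ 2 * T

lemma isUnit_of_eq_one_or {A : Type u} [CommRing A] {H U : A⟦X⟧[X]}
    (h : U = 1 ∨ IsWeierstrass H ∧ IsUnit (PowerSeries.constantCoeff (U.coeff 0))) :
    IsUnit (PowerSeries.constantCoeff (U.coeff 0)) := by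
  rcases h with rfl | h
  · simp
  · exact h.2

lemma natCast_ne_zero_of_le {d : ℕ} (hchar : ringChar K = 0 ∨ d < ringChar K) {L : Type*} [Field L]
    [Algebra K L] {n : ℕ} (h0 : 0 < n) (hn : n ≤ d) : (n : L) ≠ 0 := by
  have h1 : (n : K) ≠ 0 := by
    rw [Ne, ringChar.spec]
    intro h
    rcases hchar with h2 | h2
    · rw [h2, zero_dvd_iff] at h
      omega
    · exact absurd (Nat.le_of_dvd h0 h) (by omega)
  rw [← map_natCast (algebraMap K L)]
  exact (_root_.map_ne_zero _).2 h1

lemma order_map_of_injective {A B : Type*} [CommRing A] [CommRing B] {φ : A →+* B}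
    (hφ : Function.Injective φ) (f : A⟦X⟧) : (PowerSeries.map φ f).order = f.order := by
  refine le_antisymm (le_order _ _ fun i hi => hφ ?_) (le_order_map φ)
  rw [← PowerSeries.coeff_map, coeff_of_lt_order i hi, map_zero]

lemma isBalanced_initial {F : K⟦X⟧[X]} (hmonic : F.Monic) (hdeg : 0 < F.natDegree) {δ : ℕ}
    (hδ : F.discr.order = δ) : IsBalanced K F.natDegree δ (depress F) 1 (depress F) where
  isIntegral := ⟨RingHom.id K, RingHom.isIntegral_of_surjective _ Function.surjective_id⟩
  monic := monic_depress hmonic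
  pos := by rwa [natDegree_depress]
  eq_X h := depress_eq_X hmonic (by rwa [natDegree_depress] at h)
  e_pos := one_pos
  exists_points := by
    refine ⟨0, 1, {algebraMap K _}, δ, 0, by simp, .inl rfl, by simp [natDegree_depress], ?_,
      by simp, by simp, by simp⟩
    rw [Multiset.map_singleton, Multiset.sum_singleton, discrOrder_map_depress, discrOrder,
      resultant_derivative_map _ hmonic, order_map_of_injective (RingHom.injective _)]
    exact (discrOrder_eq hmonic hdeg).trans hδ

/-- The alternative on `U` in the invariant accounts for the first step, which may have `m = 0` and
move the origin: there `U = 1`. Afterwards `H` is Weierstrass, so `m > 0` and the unit `U` pulls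
back to a unit. -/
lemma IsBalanced.transform [PerfectField K] {d δ : ℕ} (hchar : ringChar K = 0 ∨ d < ringChar K)
    (hd : 0 < d) {A : Type u} [CommRing A] {H : A⟦X⟧[X]} {e : ℕ} {Fk : A⟦X⟧[X]}
    (h : IsBalanced K d δ H e Fk) (hN : 1 < H.natDegree) {q m : ℕ} {P : A[X]} {N : ℕ}
    (hedge : IsEdgeData H q m P N) {s t : ℕ} (hst : q * s = t * m + 1)
    {G : (AdjoinRoot P)⟦X⟧[X]} (hG : IsTransform H q hedge.q_pos.ne' m s t P N G) :
    IsBalanced K d δ (depress G) (e * q)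
      (pullback (AdjoinRoot.of P) (AdjoinRoot.root P ^ t) q hedge.q_pos.ne' m
        (PowerSeries.C (AdjoinRoot.root P ^ s) + shift G) Fk) := by
  obtain ⟨ι, hι⟩ := h.isIntegral
  obtain ⟨v, U, Φ, D, T, hF, hU, hcard, hD, hδ, hT1, hT2⟩ := h.exists_points
  obtain ⟨hGW, hGN, V, hV, hHV⟩ := hG
  have hΦ : 0 < Φ.card := Nat.pos_of_ne_zero fun h0 => by simp [h0] at hcard; omega
  obtain ⟨φ₀, -⟩ := Multiset.card_pos_iff_exists_mem.1 hΦ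
  have : Nontrivial A := φ₀.domain_nontrivial
  have hn := hedge.natDegree_eq h.monic
  have hNpos : 0 < N := Nat.pos_of_ne_zero fun h0 => by simp [h0] at hn; omega
  have hl : 0 < P.natDegree := Nat.pos_of_ne_zero fun h0 => by simp [h0] at hn; omega
  have hB : Nontrivial (AdjoinRoot P) := Ideal.Quotient.nontrivial_iff.2 fun htop =>
    hl.ne' (by
      have h1 := hedge.monic.isUnit_iff.1 (Ideal.span_singleton_eq_top.1 htop)
      rw [h1, natDegree_one])
  obtain ⟨Q, hQ, hHQ⟩ := hGW.exists_eq_mul hV hHV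
  -- The power of `x` split off at this step is `x^(mN)` with `N` the degree of the old `H`; hence
  -- the new valuation `q v + m N` below.
  have hw : q * m * P.natDegree * N = m * H.natDegree := by rw [hn]; ring
  rw [hw] at hHQ
  have hGpos : 0 < G.natDegree := hGN.symm ▸ hNpos
  have hnd : H.natDegree ≤ d := by
    rw [← hcard]; exact Nat.le_mul_of_pos_left _ (Nat.mul_pos h.e_pos hΦ)
  have hstep := fun φ : A →+* AlgebraicClosure K => exists_points_adjoinRoot hι φ h.monic
    (natCast_ne_zero_of_le hchar h.pos hnd) hedge hst hGW hGN hHQ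
  choose Ψ hΨcard hΨ using hstep
  have hqD : (q : ℕ∞) * D = ((Φ.card * (H.natDegree * (H.natDegree - 1) * m) : ℕ) : ℕ∞) +
      q * ((Φ.bind Ψ).map fun ψ => discrOrder ((depress G).map (PowerSeries.map ψ))).sum := by
    rw [← hD, ← Multiset.sum_map_mul_left, Multiset.map_congr rfl fun φ _ => hΨ φ,
      Multiset.sum_map_add, Multiset.sum_map_mul_left, Multiset.map_const', Multiset.sum_replicate,
      Multiset.map_bind, Multiset.sum_bind]
    simp only [discrOrder_map_depress, nsmul_eq_mul]
    push_cast
    rfl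
  -- The new discriminants are nonzero: `q` times their total order is bounded by the finite `q D`.
  obtain ⟨D', hD'⟩ : ∃ D' : ℕ,
      ((Φ.bind Ψ).map fun ψ => discrOrder ((depress G).map (PowerSeries.map ψ))).sum = D' := by
    refine (ENat.ne_top_iff_exists.1 fun htop => ?_).imp fun _ h => h.symm
    rw [htop, ENat.mul_top (by exact_mod_cast hedge.q_pos.ne'), add_top] at hqD
    exact ENat.natCast_ne_top (q * D) (by exact_mod_cast hqD)
  rw [hD'] at hqD
  have hqDr : (q : ℝ) * D = Φ.card * (H.natDegree * (H.natDegree - 1) * m) + q * D' := by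
    have h1 : q * D = Φ.card * (H.natDegree * (H.natDegree - 1) * m) + q * D' := by
      exact_mod_cast hqD
    have h2 : ((H.natDegree - 1 : ℕ) : ℝ) = H.natDegree - 1 := by
      rw [Nat.cast_sub hN.le, Nat.cast_one]
    rw [← h2]
    exact_mod_cast h1
  have hroot := isUnit_root_of_isUnit_coeff_zero hedge.isUnit_coeff_zero
  have hq0 : (0 : ℝ) < q := by exact_mod_cast hedge.q_pos
  have he0 : (0 : ℝ) < e := by exact_mod_cast h.e_pos
  refine ⟨⟨_, isIntegral_comp_of hι hedge.monic⟩, monic_depress hGW.1,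
    by rwa [natDegree_depress], fun h1 => depress_eq_X hGW.1 (by rwa [natDegree_depress] at h1),
    Nat.mul_pos h.e_pos hedge.q_pos, q * v + m * H.natDegree,
    Polynomial.C (PowerSeries.C ((AdjoinRoot.root P ^ t) ^ v)) * Q.taylor (shift G) *
      pullback (AdjoinRoot.of P) (AdjoinRoot.root P ^ t) q hedge.q_pos.ne' m
        (PowerSeries.C (AdjoinRoot.root P ^ s) + shift G) U, Φ.bind Ψ, D',
    T + Φ.card * (H.natDegree * (H.natDegree - 1) * m) / q, ?_, .inr ⟨hGW.depress hGpos, ?_⟩,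
    ?_, hD', ?_, ?_, ?_⟩
  · rw [hF, map_mul, map_mul, pullback_C_X_pow, pullback_add _ _ _ _ _ _ H, hHQ, taylor_mul,
      taylor_mul, taylor_C, depress_eq_taylor, pow_add, map_mul]
    ring
  · rw [Polynomial.mul_coeff_zero, Polynomial.mul_coeff_zero, map_mul, map_mul,
      Polynomial.coeff_C_zero, constantCoeff_C, taylor_apply, constantCoeff_coeff_zero_comp _ _
        (by simpa using constantCoeff_shift hGW hGpos)]
    refine (((hroot.pow t).pow v).mul hQ).mul ?_
    rcases hU with rfl | ⟨hHW, hU⟩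
    · simp
    · rw [constantCoeff_coeff_zero_pullback _ _ _ (hedge.pos_of_isWeierstrass hHW h.pos)]
      exact hU.map _
  · rw [Multiset.card_bind, show Multiset.card ∘ Ψ = fun _ => P.natDegree from funext hΨcard,
      Multiset.map_const',
      Multiset.sum_replicate, natDegree_depress, hGN, ← hcard, hn, smul_eq_mul]
    ring
  · rw [hδ]
    field_simp
    linarith
  all_goals
    -- Substituting `d = e |Φ| N` turns the growth of `d v / e` into `|Φ| N² m / q`, to be compared
    -- with the growth `|Φ| N (N - 1) m / q` of `T`.
    have hsplit : (d : ℝ) * (((q * v + m * H.natDegree : ℕ) : ℝ) / ((e * q : ℕ) : ℝ)) =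
        d * (v / e) + Φ.card * (H.natDegree * H.natDegree * m) / q := by
      rw [← hcard]
      push_cast
      field_simp
    rw [hsplit]
    have hNr : (2 : ℝ) ≤ H.natDegree := by exact_mod_cast hN
  · have : (Φ.card : ℝ) * (H.natDegree * (H.natDegree - 1) * m) / q ≤
        Φ.card * (H.natDegree * H.natDegree * m) / q := by
      gcongr
      linarith
    linarith
  · have : (Φ.card : ℝ) * (H.natDegree * H.natDegree * m) / q ≤
        2 * (Φ.card * (H.natDegree * (H.natDegree - 1) * m) / q) := by
      rw [← mul_div_assoc]
      refine div_le_div_of_nonneg_right ?_ hq0.le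
      have : (H.natDegree : ℝ) * H.natDegree * m ≤
          H.natDegree * (2 * (H.natDegree - 1)) * m := by
        gcongr
        linarith
      calc (Φ.card : ℝ) * (H.natDegree * H.natDegree * m)
          ≤ Φ.card * (H.natDegree * (2 * (H.natDegree - 1)) * m) := by gcongr
        _ = _ := by ring
    linarith

lemma Reaches.isBalanced [PerfectField K] {F : K⟦X⟧[X]} (hmonic : F.Monic)
    (hdeg : 0 < F.natDegree) (hchar : ringChar K = 0 ∨ F.natDegree < ringChar K) {δ : ℕ}
    (hδ : F.discr.order = δ) {k : ℕ} {S : Stage K} (hS : Reaches F k S) :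
    IsBalanced K F.natDegree δ S.H S.e (S.pull F) := by
  induction hS with
  | zero => exact isBalanced_initial hmonic hdeg hδ
  | succ _ hN hedge hst _ hG ih => exact ih.transform hchar hdeg hN hedge hst hG

section Bounds

variable {d δ : ℕ} {A : Type u} [CommRing A] {H : A⟦X⟧[X]} {e : ℕ} {Fk : A⟦X⟧[X]}

lemma IsBalanced.nontrivial (hd : 0 < d) (h : IsBalanced K d δ H e Fk) : Nontrivial A := by
  obtain ⟨-, -, Φ, -, -, -, -, hcard, -⟩ := h.exists_points
  have hΦ : 0 < Φ.card := Nat.pos_of_ne_zero fun h0 => by simp [h0] at hcard; omega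
  obtain ⟨φ, -⟩ := Multiset.card_pos_iff_exists_mem.1 hΦ
  exact φ.domain_nontrivial

/-- The term `N m / (e q)` is charged to the remaining discriminant: the line through the lowest
edge forces `|Φ| N (N - 1) m / q ≤ D`. For `N ≥ 2` twice this dominates `|Φ| N² m / q`; for `N = 1`,
`H = y` has slope zero. -/
lemma IsBalanced.eta_le (hchar : ringChar K = 0 ∨ d < ringChar K) (hd : 0 < d)
    (h : IsBalanced K d δ H e Fk) {v q m : ℕ} (hv : val Fk = v) (hs : HasLowestSlope H q m) :
    (v : ℝ) / e + H.natDegree * m / (e * q) ≤ 2 * δ / d := by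
  have := h.nontrivial hd
  obtain ⟨v', U, Φ, D, T, hF, hU, hcard, hD, hδ, hT1, hT2⟩ := h.exists_points
  rw [hF, val_eq h.monic (isUnit_of_eq_one_or hU), Nat.cast_inj] at hv
  subst hv
  have hΦ : 0 < Φ.card := Nat.pos_of_ne_zero fun h0 => by simp [h0] at hcard; omega
  have hnd : H.natDegree ≤ d := by
    rw [← hcard]; exact Nat.le_mul_of_pos_left _ (Nat.mul_pos h.e_pos hΦ)
  have hq0 : (0 : ℝ) < q := by exact_mod_cast hs.pos
  have he0 : (0 : ℝ) < e := by exact_mod_cast h.e_pos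
  have hd0 : (0 : ℝ) < d := by exact_mod_cast hd
  have hD' : Φ.card * (H.natDegree * (H.natDegree - 1) * m) ≤ q * D := by
    have h1 : ∀ φ ∈ Φ, ((H.natDegree * (H.natDegree - 1) * m : ℕ) : ℕ∞) ≤
        q * discrOrder (H.map (PowerSeries.map φ)) := by
      intro φ _
      have hdeg := h.monic.natDegree_map (PowerSeries.map φ)
      have := le_smul_discrOrder (h.monic.map (PowerSeries.map φ)) (q := q) (m := m)
        hs.pos.ne' (by rw [hdeg]; exact natCast_ne_zero_of_le hchar h.pos hnd) fun i => by
          rw [hdeg, Polynomial.coeff_map]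
          -- Passing to a geometric point can only raise the orders of the coefficients, so the
          -- lower bound persists.
          refine le_trans ?_ (mul_le_mul_right (le_order_map φ) (q : ℕ∞))
          rcases eq_or_ne (H.coeff i) 0 with h0 | h0
          · rw [h0, order_zero, ENat.mul_top (by exact_mod_cast hs.pos.ne')]
            exact le_top
          · have h2 := hs.le (coe_toNat_order h0).symm
            rw [← coe_toNat_order h0, Nat.mul_sub]
            exact_mod_cast (by omega : m * H.natDegree - m * i ≤ q * (H.coeff i).order.toNat)
      rwa [hdeg] at this
    have h2 := Multiset.sum_map_le_sum_map _ _ h1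
    rw [Multiset.sum_map_mul_left, hD, Multiset.map_const', Multiset.sum_replicate,
      nsmul_eq_mul] at h2
    exact_mod_cast h2
  have hD'r : (Φ.card : ℝ) * (H.natDegree * (H.natDegree - 1) * m) ≤ q * D := by
    have h2 : ((H.natDegree - 1 : ℕ) : ℝ) = H.natDegree - 1 := by
      rw [Nat.cast_sub h.pos, Nat.cast_one]
    rw [← h2]
    exact_mod_cast hD'
  rw [le_div_iff₀ hd0, add_mul]
  have hsplit : (H.natDegree : ℝ) * m / (e * q) * d =
      Φ.card * (H.natDegree * H.natDegree * m) / q := by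
    rw [← hcard]
    push_cast
    field_simp
  have hle : (Φ.card : ℝ) * (H.natDegree * H.natDegree * m) / q ≤ 2 * D := by
    rw [div_le_iff₀ hq0]
    rcases (Nat.succ_le_of_lt h.pos).eq_or_lt with h1 | h1
    · have hX := h.eq_X h1.symm
      rw [hX] at hs
      rw [hs.eq_zero_of_eq_X]
      have : (0 : ℝ) ≤ 2 * D * q := by positivity
      simpa using this
    · have hNr : (2 : ℝ) ≤ H.natDegree := by exact_mod_cast h1
      have : (H.natDegree : ℝ) * H.natDegree * m ≤
          H.natDegree * (2 * (H.natDegree - 1)) * m := by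
        gcongr
        linarith
      have : (Φ.card : ℝ) * (H.natDegree * H.natDegree * m) ≤
          Φ.card * (H.natDegree * (2 * (H.natDegree - 1)) * m) := by gcongr
      linarith
  rw [hsplit]
  linarith

lemma IsBalanced.exists_val_eq (hd : 0 < d) (h : IsBalanced K d δ H e Fk) :
    ∃ v : ℕ, val Fk = v ∧ (H.natDegree = 1 → (δ : ℝ) / d ≤ v / e) := by
  have := h.nontrivial hd
  obtain ⟨v, U, Φ, D, T, hF, hU, hcard, hD, hδ, hT1, hT2⟩ := h.exists_points
  refine ⟨v, by rw [hF, val_eq h.monic (isUnit_of_eq_one_or hU)], fun h1 => ?_⟩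
  have hD0 : D = 0 := by
    rw [h.eq_X h1] at hD
    have : ∀ φ ∈ Φ, discrOrder ((Polynomial.X : A⟦X⟧[X]).map (PowerSeries.map φ)) = 0 := by
      intro φ _
      simp [discrOrder]
    rw [Multiset.map_congr rfl this, Multiset.map_const', Multiset.sum_replicate,
      smul_zero] at hD
    exact_mod_cast hD.symm
  rw [div_le_iff₀ (by exact_mod_cast hd), hδ, hD0]
  linarith

/-- Both `e` and `q` are at most `d`, since `e |Φ| N = d` and `q ≤ N`; so each divides `d!`, and
`d!²` is a denominator common to all ranks. -/
lemma IsBalanced.exists_mul_eq_natCast (hd : 0 < d) (h : IsBalanced K d δ H e Fk) (v : ℕ)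
    {q m : ℕ} (hs : HasLowestSlope H q m) :
    ∃ a : ℕ, ((v : ℝ) / e + H.natDegree * m / (e * q)) * (d.factorial * d.factorial : ℕ) = a := by
  obtain ⟨-, -, Φ, -, -, -, -, hcard, -⟩ := h.exists_points
  have hq0 : (0 : ℝ) < q := by exact_mod_cast hs.pos
  have he0 : (0 : ℝ) < e := by exact_mod_cast h.e_pos
  have hHd : H.natDegree ≤ d := Nat.le_of_dvd hd (hcard ▸ dvd_mul_left _ _)
  obtain ⟨a, ha⟩ : e ∣ d.factorial := Nat.dvd_factorial h.e_pos
    (Nat.le_of_dvd hd (hcard ▸ (dvd_mul_right e Φ.card).mul_right _))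
  obtain ⟨b, hb⟩ : q ∣ d.factorial :=
    Nat.dvd_factorial hs.pos ((hs.le_natDegree h.pos).trans hHd)
  refine ⟨v * a * d.factorial + H.natDegree * m * a * b, ?_⟩
  have ha' : (d.factorial : ℝ) = e * a := by exact_mod_cast ha
  have hb' : (d.factorial : ℝ) = q * b := by exact_mod_cast hb
  rw [add_mul]
  push_cast
  congr 1
  · rw [ha']; field_simp
  · nth_rw 1 [ha']
    rw [hb']
    field_simp

end Bounds

end Sequence

end QuasiIrred

theorem mainTheorem8 {K : Type*} [Field K] [PerfectField K] (F : K⟦X⟧[X])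
    (hmonic : F.Monic) (hdeg : 0 < F.natDegree)
    (hchar : ringChar K = 0 ∨ F.natDegree < ringChar K)
    (hsep : (F.map (algebraMap K⟦X⟧ (LaurentSeries K))).Separable)
    (δ : ℕ) (hδ : F.discr.order = δ) :
    IsGreatest (QuasiIrred.etaValues F) (QuasiIrred.eta F) ∧
      QuasiIrred.eta F ≤ 2 * (δ : ℝ) / F.natDegree ∧
      (QuasiIrred.QuasiIrreducible F → (δ : ℝ) / F.natDegree ≤ QuasiIrred.eta F) := by
  have hbal := fun {k : ℕ} {S : QuasiIrred.Stage K} (hS : QuasiIrred.Reaches F k S) =>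
    hS.isBalanced hmonic hdeg hchar hδ
  have hle : ∀ r ∈ QuasiIrred.etaValues F, r ≤ 2 * (δ : ℝ) / F.natDegree := by
    rintro r ⟨k, S, v, q, m, hS, hv, hs, rfl⟩
    exact (hbal hS).eta_le hchar hdeg hv hs
  have hmem : ∀ {k : ℕ} {S : QuasiIrred.Stage K}, QuasiIrred.Reaches F k S → ∀ v : ℕ,
      S.v F = v → ∃ q m : ℕ, (v : ℝ) / S.e + (S.N : ℝ) * m / ((S.e : ℝ) * q) ∈
        QuasiIrred.etaValues F := by
    intro k S hS v hv
    have := (hbal hS).nontrivial hdeg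
    obtain ⟨q, m, hs⟩ := QuasiIrred.exists_hasLowestSlope (hbal hS).monic
    exact ⟨q, m, k, S, v, q, m, hS, hv, hs, rfl⟩
  have hne : (QuasiIrred.etaValues F).Nonempty := by
    obtain ⟨v, hv, -⟩ := (hbal QuasiIrred.Reaches.zero).exists_val_eq hdeg
    obtain ⟨q, m, h⟩ := hmem QuasiIrred.Reaches.zero v hv
    exact ⟨_, h⟩
  -- Nonnegative multiples of `1 / d!²` below a fixed bound are finite in number, so no separate
  -- termination argument for the sequence is needed.
  have hfin : (QuasiIrred.etaValues F).Finite := by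
    set M : ℕ := F.natDegree.factorial * F.natDegree.factorial
    have hM : (0 : ℝ) < M := by
      exact_mod_cast Nat.mul_pos (Nat.factorial_pos _) (Nat.factorial_pos _)
    refine ((Set.finite_Iic ⌊2 * (δ : ℝ) / F.natDegree * M⌋₊).image
      fun a : ℕ => (a : ℝ) / M).subset fun r hr => ?_
    have hr' := hle r hr
    obtain ⟨k, S, v, q, m, hS, hv, hs, rfl⟩ := hr
    obtain ⟨a, ha⟩ := (hbal hS).exists_mul_eq_natCast hdeg v hs
    refine ⟨a, Nat.le_floor ?_, ?_⟩
    · rw [← ha]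
      exact mul_le_mul_of_nonneg_right hr' hM.le
    · exact (div_eq_iff hM.ne').2 ha.symm
  refine ⟨⟨hne.csSup_mem hfin, fun r hr => le_csSup hfin.bddAbove hr⟩,
    csSup_le hne hle, ?_⟩
  rintro ⟨g, S, hS, hN⟩
  obtain ⟨v, hv, h1⟩ := (hbal hS).exists_val_eq hdeg
  obtain ⟨q, m, h⟩ := hmem hS v hv
  -- Already the first term `v / e` of the last `η_k` reaches `δ / d`.
  refine (h1 hN).trans (le_trans ?_ (le_csSup hfin.bddAbove h))
  exact le_add_of_nonneg_right (by positivity)
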